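/- Let $d\ge 2$, $\varepsilon\in(0,1)$; all logarithms are to base two and $0\log 0=0$. In $\mathbb C^d$ with computational basis $\{|x\rangle\}_{x=1}^d$, let $\mathcal M_d=\{M_x\}_x$ be the noisy projective measurement $M_x=(1-\varepsilon)|x\rangle\langle x|+\frac{\varepsilon}{d}\mathbb 1$, let $|\psi\rangle=\frac1{\sqrt d}(1,\dots,1)^T$ be the unbiased state, let $\rho_\psi=(1-\varepsilon)|\psi\rangle\langle\psi|+\frac{\varepsilon}{d}\mathbb 1$, and put $P^*=\frac1d(\operatorname{tr}\sqrt{M_1})^2$ (any $M_k$ in place of $M_1$ gives the same value). *Entropies.* For an ensemble $\{p(x)\rho_x\}$ of states held by Eve put $$H(X|E)=-\sum_x p(x)\log p(x)+\sum_x p(x)S(\rho_x)-S\Big(\sum_x p(x)\rho_x\Big),\qquad S(\sigma)=-\operatorname{tr}(\sigma\log\sigma),$$ $$H_{\max}(X|E)=\log\max_\sigma\Big(\sum_x\sqrt{p(x)}\,F(\rho_x,\sigma)\Big)^2,\qquad F(\rho,\sigma)=\operatorname{tr}\sqrt{\sqrt\rho\,\sigma\sqrt\rho},$$ the maximum being over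 states $\sigma$ of Eve. $H_2(x)=-x\log x-(1-x)\log(1-x)$. *Dilations.* A dilation of $\mathcal M_d$ consists of finite-dimensional systems $A,E$, a projective measurement $\{\Pi_x\}$ on $S\otimes A$ ($S=\mathbb C^d$) and a unit vector $|\varphi\rangle_{AE}$ such that $\operatorname{tr}_A(\Pi_x(\mathbb 1_S\otimes\operatorname{tr}_E|\varphi\rangle\langle\varphi|))=M_x$ for all $x$. For the state $|\psi\rangle_S$ it gives Eve the ensemble $p(x)\rho_{x,E}=\operatorname{tr}_{SA}\big((\Pi_x\otimes\mathbb 1_E)\,|\psi\rangle\langle\psi|_S\otimes|\varphi\rangle\langle\varphi|_{AE}\big)$. Write $H(X|E,|\psi\rangle,\mathcal M_d)$ and $H_{\max}(X|E,|\psi\rangle,\mathcal M_d)$ for the infima, over all dilations, of $H(X|E)$ and $H_{\max}(X|E)$ of this ensemble. *Square-root dilation.* Let $K_{x,j}=|\psi_{xj}\rangle\langle\psi_{xj}|$ for $x\ne j$, with $|\psi_{xj}\rangle=\sqrt{M_x}(\langle\psi|j\rangle|x\rangle-\langle\psi|x\rangle|j\rangle)$, and $K_{x,x}=\sqrt{M_x}|\psi\rangle\langle\psi|\sqrt{M_x}+\frac{(d-1)\varepsilon}{d^2}(\mathbb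 1_{\ne x}-|\psi_{\ne x}\rangle\langle\psi_{\ne x}|)$, where $\mathbb 1_{\neq x}=\mathbb 1-|x\rangle\langle x|$ and $|\psi_{\ne x}\rangle=\sqrt{d/(d-1)}\,\mathbb 1_{\ne x}|\psi\rangle$. Put $p(j)=\frac1d\sum_x\operatorname{tr}K_{x,j}$ and $N_{x,j}=K_{x,j}/p(j)$. Take $A=A_1\otimes A_2$ with $A_1,A_2,E$ copies of $\mathbb C^d$, fix a basis vector $|x_0\rangle$ of $A_1$, let $|\varphi\rangle=|x_0\rangle_{A_1}\otimes\sum_j\sqrt{p(j)}|jj\rangle_{A_2E}$ and $\Pi_x=U^\dagger(\mathbb 1_S\otimes|x\rangle\langle x|_{A_1}\otimes\mathbb 1_{A_2})U$, where $U$ is any unitary with $U|\phi,x_0,j\rangle=\sum_x\sqrt{N_{x,j}}\,|\phi,x,j\rangle$ for all $|\phi\rangle$ and $j$. Then such a $U$ exists for every $x_0$; for every such $U$ the above is a dilation of $\mathcal M_d$, and for $|\psi\rangle$ it gives $H(X|E)=H_2(P^*)+(1-P^*)\log(d-1)$ and $H_{\max}(X|E)=\log(d-(d-1)\varepsilon)$.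 Consequently $$H(X|E,|\psi\rangle,\mathcal M_d)\le H_2(P^*)+(1-P^*)\log(d-1),\qquad H_{\max}(X|E,|\psi\rangle,\mathcal M_d)\le\log(d-(d-1)\varepsilon)=H^*_{\max}(\rho_\psi).$$ Here $H^*_{\max}(\rho_\psi)$ is the maximum, over all orthonormal bases of $S$, of $H_{\max}(X|E)$ when $S$ is measured in that basis and Eve holds a purification of $\rho_\psi$; the maximum is attained and has this value for every finite-dimensional purification. -/

import Mathlib

open scoped Matrix Kronecker ComplexOrder

namespace NoisyMeasurement

noncomputable section

section General

variable {S A E X : Type} [Fintype S] [DecidableEq S] [Fintype A] [DecidableEq A]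
  [Fintype E] [DecidableEq E] [Fintype X]

/-- The rank-one operator `|v⟩⟨v|`. -/
def ketbra {I : Type} (v : I → ℂ) : Matrix I I ℂ :=
  Matrix.vecMulVec v (star v)

/-- The square root of a positive semidefinite matrix (spectral functional calculus). -/
def psdSqrt (M : Matrix S S ℂ) : Matrix S S ℂ :=
  cfc Real.sqrt M

/-- Partial trace over the first tensor factor. -/
def traceFst (M : Matrix (S × E) (S × E) ℂ) : Matrix E E ℂ :=
  Matrix.of fun e f => ∑ s, M (s, e) (s, f)

/-- Partial trace over the second tensor factor. -/
def traceSnd (M : Matrix (S × E) (S × E) ℂ) : Matrix S S ℂ :=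
  Matrix.of fun s t => ∑ e, M (s, e) (t, e)

/-- The von Neumann entropy `S(σ) = -tr (σ log σ)` in bits (with `0 log 0 = 0`). -/
def vonNeumannEntropy (σ : Matrix E E ℂ) : ℝ :=
  -(σ * cfc (Real.logb 2) σ).trace.re

/-- The quantum fidelity `F(ρ, σ) = tr √(√ρ σ √ρ)`. -/
def fidelity (ρ σ : Matrix E E ℂ) : ℝ :=
  (psdSqrt (psdSqrt ρ * σ * psdSqrt ρ)).trace.re

/-- Density matrices: positive semidefinite of unit trace. -/
def IsState (σ : Matrix E E ℂ) : Prop :=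
  σ.PosSemidef ∧ σ.trace = 1

/-! An ensemble `{p(x) ρ_x}` held by Eve is given by its subnormalized states
`ω x = p(x) ρ_x`. -/

/-- The probability `p(x) = tr (ω x)`. -/
def prob (ω : X → Matrix E E ℂ) (x : X) : ℝ :=
  (ω x).trace.re

/-- The normalized conditional state `ρ_x = ω x / p(x)` (irrelevant when `p(x) = 0`). -/
def condState (ω : X → Matrix E E ℂ) (x : X) : Matrix E E ℂ :=
  ((prob ω x)⁻¹ : ℂ) • ω x

/-- The conditional von Neumann entropy
`H(X|E) = H({p(x)}) + ∑ p(x) S(ρ_x) - S(∑ p(x) ρ_x)`. -/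
def condEntropy (ω : X → Matrix E E ℂ) : ℝ :=
  (-∑ x, prob ω x * Real.logb 2 (prob ω x))
    + ∑ x, prob ω x * vonNeumannEntropy (condState ω x)
    - vonNeumannEntropy (∑ x, ω x)

/-- `p_secr = max_σ (∑ √p(x) F(ρ_x, σ))²`, over all states `σ` of Eve. -/
def secrecy (ω : X → Matrix E E ℂ) : ℝ :=
  sSup {r : ℝ | ∃ σ : Matrix E E ℂ, IsState σ ∧
    r = (∑ x, Real.sqrt (prob ω x) * fidelity (condState ω x) σ) ^ 2}

/-- The conditional max-entropy `H_max(X|E) = log p_secr`. -/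
def condMaxEntropy (ω : X → Matrix E E ℂ) : ℝ :=
  Real.logb 2 (secrecy ω)

/-- A generalized Naimark dilation of the measurement `M` on `S`: a projective measurement `P`
on `S ⊗ A` and a unit vector `v` of `A ⊗ E` such that, with `σ_A = tr_E |v⟩⟨v|`,
`tr_A (P x (1 ⊗ σ_A)) = M x`. -/
structure IsDilation (M : X → Matrix S S ℂ) (P : X → Matrix (S × A) (S × A) ℂ)
    (v : A × E → ℂ) : Prop where
  proj : ∀ x, IsStarProjection (P x)
  orth : ∀ x y, x ≠ y → P x * P y = 0
  sum_eq : ∑ x, P x = 1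
  unit : ∑ i, ‖v i‖ ^ 2 = 1
  marginal : ∀ x,
    traceSnd (P x * ((1 : Matrix S S ℂ) ⊗ₖ traceSnd (ketbra v))) = M x

/-- The vector `|φ⟩_S ⊗ |v⟩_{AE}` of `S ⊗ A ⊗ E`. -/
def jointVec (φ : S → ℂ) (v : A × E → ℂ) : (S × A) × E → ℂ :=
  fun i => φ i.1.1 * v (i.1.2, i.2)

/-- Subnormalized post-measurement states of Eve,
`p(x) ρ_{x,E} = tr_{SA} ((P x ⊗ 1_E) (|φ⟩⟨φ| ⊗ |v⟩⟨v|))`. -/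
def eveEnsemble (φ : S → ℂ) (P : X → Matrix (S × A) (S × A) ℂ) (v : A × E → ℂ) :
    X → Matrix E E ℂ :=
  fun x => traceFst ((P x ⊗ₖ (1 : Matrix E E ℂ)) * ketbra (jointVec φ v))

/-- `H(X|E, |φ⟩, M)`: the conditional von Neumann entropy minimized over all dilations. -/
def measEntropy (φ : S → ℂ) (M : X → Matrix S S ℂ) : EReal :=
  sInf {h : EReal | ∃ (A E : Type) (_ : Fintype A) (_ : DecidableEq A) (_ : Fintype E)
    (_ : DecidableEq E) (P : X → Matrix (S × A) (S × A) ℂ) (v : A × E → ℂ),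
    IsDilation M P v ∧ h = (condEntropy (eveEnsemble φ P v) : ℝ)}

/-- `H_max(X|E, |φ⟩, M)`: the conditional max-entropy minimized over all dilations. -/
def measMaxEntropy (φ : S → ℂ) (M : X → Matrix S S ℂ) : EReal :=
  sInf {h : EReal | ∃ (A E : Type) (_ : Fintype A) (_ : DecidableEq A) (_ : Fintype E)
    (_ : DecidableEq E) (P : X → Matrix (S × A) (S × A) ℂ) (v : A × E → ℂ),
    IsDilation M P v ∧ h = (condMaxEntropy (eveEnsemble φ P v) : ℝ)}

/-- Subnormalized states of Eve after the system `S` of a vector `Φ` of `S ⊗ E` is measured in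
an orthonormal basis: `tr_S ((|b x⟩⟨b x| ⊗ 1_E) |Φ⟩⟨Φ|)`. -/
def basisEnsemble (b : OrthonormalBasis S ℂ (EuclideanSpace ℂ S)) (Φ : S × E → ℂ) :
    S → Matrix E E ℂ :=
  fun x => traceFst ((ketbra (fun i => b x i) ⊗ₖ (1 : Matrix E E ℂ)) * ketbra Φ)

/-- The values of `H_max(X|E)` that arise when the system `S` of the purification `Φ` is
measured in some orthonormal basis. -/
def basisMaxEntropies (Φ : S × E → ℂ) : Set ℝ :=
  {h : ℝ | ∃ b : OrthonormalBasis S ℂ (EuclideanSpace ℂ S),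
    h = condMaxEntropy (basisEnsemble b Φ)}

end General

/-- The binary Shannon entropy, in bits. -/
def binaryEntropy (x : ℝ) : ℝ :=
  -x * Real.logb 2 x - (1 - x) * Real.logb 2 (1 - x)

/-- The computational basis vector `|x⟩`. -/
def ket {d : ℕ} (x : Fin d) : Fin d → ℂ :=
  Pi.single x 1

/-- The depolarizing channel `Δ_ε(σ) = (1 - ε) σ + (ε / d) tr(σ) 1`. -/
def depolarize {d : ℕ} (ε : ℝ) (σ : Matrix (Fin d) (Fin d) ℂ) : Matrix (Fin d) (Fin d) ℂ :=
  ((1 - ε : ℝ) : ℂ) • σ + (((ε / d : ℝ) : ℂ) * σ.trace) • (1 : Matrix (Fin d) (Fin d) ℂ)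

/-- The noisy projective measurement `M_x = Δ_ε(|x⟩⟨x|)`. -/
def noisyMeas (d : ℕ) (ε : ℝ) (x : Fin d) : Matrix (Fin d) (Fin d) ℂ :=
  depolarize ε (ketbra (ket x))

/-- The unbiased state `|ψ⟩ = (1, ..., 1) / √d`. -/
def unbiased (d : ℕ) : Fin d → ℂ :=
  fun _ => ((Real.sqrt d)⁻¹ : ℝ)

/-- The noisy state `ρ_ψ = Δ_ε(|ψ⟩⟨ψ|)`. -/
def noisyState (d : ℕ) (ε : ℝ) : Matrix (Fin d) (Fin d) ℂ :=
  depolarize ε (ketbra (unbiased d))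

/-- `(tr √M_k)² / d`. -/
def pStar (d : ℕ) (ε : ℝ) (k : Fin d) : ℝ :=
  (psdSqrt (noisyMeas d ε k)).trace.re ^ 2 / d

/-- The projector `1_{≠x} = ∑_{k ≠ x} |k⟩⟨k|`. -/
def projNe {d : ℕ} (x : Fin d) : Matrix (Fin d) (Fin d) ℂ :=
  1 - ketbra (ket x)

/-- The unit vector `|ψ_{≠x}⟩ = √(d / (d - 1)) 1_{≠x} |ψ⟩`. -/
def unbiasedNe (d : ℕ) (x : Fin d) : Fin d → ℂ :=
  (Real.sqrt (d / (d - 1)) : ℂ) • (projNe x *ᵥ unbiased d)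

/-- The square-root decomposition of the noisy measurement for the state `|ψ⟩`:
`K_{x,x} = √M_x |ψ⟩⟨ψ| √M_x + ((d - 1) ε / d²) (1_{≠x} - |ψ_{≠x}⟩⟨ψ_{≠x}|)`, and
`K_{x,j} = |ψ_{xj}⟩⟨ψ_{xj}|` with `|ψ_{xj}⟩ = √M_x (⟨ψ|j⟩ |x⟩ - ⟨ψ|x⟩ |j⟩)` for `x ≠ j`. -/
def sqrtDecomp (d : ℕ) (ε : ℝ) (x j : Fin d) : Matrix (Fin d) (Fin d) ℂ :=
  if x = j then
    ketbra (psdSqrt (noisyMeas d ε x) *ᵥ unbiased d)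
      + (((d - 1) * ε / d ^ 2 : ℝ) : ℂ) • (projNe x - ketbra (unbiasedNe d x))
  else
    ketbra (psdSqrt (noisyMeas d ε x) *ᵥ (unbiased d j • ket x - unbiased d x • ket j))

/-- The weights `p(j) = (1/d) ∑_x tr K_{x,j}`. -/
def sqrtWeight (d : ℕ) (ε : ℝ) (j : Fin d) : ℝ :=
  (∑ x, (sqrtDecomp d ε x j).trace.re) / d

/-- The normalized measurements `N_{x,j} = K_{x,j} / p(j)`. -/
def sqrtPOVM (d : ℕ) (ε : ℝ) (x j : Fin d) : Matrix (Fin d) (Fin d) ℂ :=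
  ((sqrtWeight d ε j)⁻¹ : ℂ) • sqrtDecomp d ε x j

/-- The auxiliary system is `A = A₁ ⊗ A₂`, with `x₀` the reference label of `A₁`: the unitary
`U` satisfies `U |φ, x₀, j⟩ = ∑_x √N_{x,j} |φ, x, j⟩` for all `|φ⟩` and `j` (as matrix entries). -/
def IsSqrtUnitary (d : ℕ) (ε : ℝ) (x₀ : Fin d)
    (U : Matrix (Fin d × (Fin d × Fin d)) (Fin d × (Fin d × Fin d)) ℂ) : Prop :=
  U ∈ Matrix.unitaryGroup (Fin d × (Fin d × Fin d)) ℂ ∧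
  ∀ s t x i j : Fin d,
    U (t, (x, i)) (s, (x₀, j)) = if i = j then psdSqrt (sqrtPOVM d ε x j) t s else 0

/-- The projective measurement `U† (1_S ⊗ |x⟩⟨x| ⊗ 1_{A₂}) U`. -/
def sqrtProj {d : ℕ} (U : Matrix (Fin d × (Fin d × Fin d)) (Fin d × (Fin d × Fin d)) ℂ)
    (x : Fin d) : Matrix (Fin d × (Fin d × Fin d)) (Fin d × (Fin d × Fin d)) ℂ :=
  Uᴴ * ((1 : Matrix (Fin d) (Fin d) ℂ) ⊗ₖ
    (ketbra (ket x) ⊗ₖ (1 : Matrix (Fin d) (Fin d) ℂ))) * U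

/-- The purified auxiliary state `|x₀⟩_{A₁} ⊗ ∑_j √p(j) |j j⟩_{A₂E}`. -/
def sqrtVec (d : ℕ) (ε : ℝ) (x₀ : Fin d) : (Fin d × Fin d) × Fin d → ℂ :=
  fun i => if i.1.1 = x₀ ∧ i.1.2 = i.2 then (Real.sqrt (sqrtWeight d ε i.2) : ℂ) else 0

end

end NoisyMeasurement

/-!
Write `a` and `b` for the eigenvalues of `√M_x` on `|x⟩` and on its complement
(`eigTop`, `eigBot`). The matrix `d K_{x,j}` is `|v⟩⟨v|` with `v = a|x⟩ - b|j⟩`, up to a correction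
for `x = j` (`sqrtDecomp_apply`). Summing these entries over `x` gives `1`, and summing over `j`
gives `d M_x`; so `p(j) = 1 / d`, each `{N_{x,j}}_x` is a measurement, and the average of these
measurements is `M_x`. The first fact makes the prescribed columns of `U` orthonormal, so that they
extend to a unitary matrix (`exists_isSqrtUnitary`). The `(x₀, i), (x₀, j)` block of `Π_x` is
`δ_ij N_{x,j}` (`sqrtProj_apply`), from which the dilation property follows (`isDilation_sqrt`).

The same block formula shows that Eve holds a classical label `j` with joint weights
`⟨ψ|K_{x,j}|ψ⟩`, equal to `P* / d` for `j = x` and to `(a - b)² / d²` for `j ≠ x`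
(`eveEnsemble_sqrt`). The von Neumann entropy of such a symmetric ensemble is a Shannon entropy.
For the max-entropy, the maximally mixed state attains the value, and it is optimal by the dual bound
`2 F(ρ, σ) ≤ τ tr √ρ + τ⁻¹ tr (σ √ρ)` (`two_mul_fidelity_le`), since `∑ x, √ρ_x` is a multiple of the
identity and the right-hand sides then add up to a number independent of `σ`
(`secrecy_symmetricEnsemble`).

For a basis measurement on a purification, Eve's conditional states are pure: they are `|e_x⟩⟨e_x|`
up to normalization, and the quantity to be maximized is `∑ x, √⟨e_x|σ|e_x⟩`. By the Cauchy-Schwarz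
inequality its square is at most `d tr (σ ρ_E) ≤ d λ`, where `λ = 1 - ε + ε / d` is the largest
eigenvalue of `ρ_ψ` and hence of `ρ_E`
(`sq_sum_sqrt_prob_mul_fidelity_basisEnsemble_le`). Equality holds for the computational basis and
the top eigenstate of `ρ_E` (`exists_state_sq_sum_sqrt_prob_mul_fidelity_eq`), and
`d λ = d - (d - 1) ε`.
-/


open scoped Matrix Kronecker ComplexOrder

namespace NoisyMeasurement

/-! ### Functional calculus of matrices -/

section FunctionalCalculus

variable {S : Type} [Fintype S] [DecidableEq S]

theorem psdSqrt_mul_self_of_posSemidef {R : Matrix S S ℂ} (hR : R.PosSemidef) :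
    psdSqrt (R * R) = R := by
  have hnn := (Matrix.posSemidef_iff_isHermitian_and_spectrum_nonneg.1 hR).2
  have hsa : IsSelfAdjoint R := hR.1
  have h := cfc_comp_pow (R := ℝ) Real.sqrt 2 R Real.continuous_sqrt.continuousOn hsa
  rw [psdSqrt, ← pow_two, ← h]
  conv_rhs => rw [← cfc_id' ℝ R hsa]
  refine cfc_congr fun x hx => Real.sqrt_sq ?_
  have := hnn ((spectrum.algebraMap_mem_iff (S := ℂ) (r := x)).2 hx)
  simpa using this

theorem psdSqrt_eq {M R : Matrix S S ℂ} (hR : R.PosSemidef) (h : R * R = M) : psdSqrt M = R :=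
  h ▸ psdSqrt_mul_self_of_posSemidef hR

theorem isHermitian_psdSqrt (M : Matrix S S ℂ) : (psdSqrt M).IsHermitian :=
  cfc_predicate Real.sqrt M

theorem posSemidef_psdSqrt (M : Matrix S S ℂ) : (psdSqrt M).PosSemidef := by
  have hB : (cfc (fun x => √√x) M).IsHermitian := cfc_predicate (fun x => √√x) M
  have h : psdSqrt M = cfc (fun x => √√x) M * (cfc (fun x => √√x) M)ᴴ := by
    rw [hB.eq, ← cfc_mul (fun x => √√x) (fun x => √√x) M]
    exact cfc_congr fun x _ => (Real.mul_self_sqrt (Real.sqrt_nonneg x)).symm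
  rw [h]
  exact Matrix.posSemidef_self_mul_conjTranspose _

theorem psdSqrt_mul_psdSqrt {M : Matrix S S ℂ} (hM : M.PosSemidef) :
    psdSqrt M * psdSqrt M = M := by
  have hnn := (Matrix.posSemidef_iff_isHermitian_and_spectrum_nonneg.1 hM).2
  have hsa : IsSelfAdjoint M := hM.1
  rw [psdSqrt, ← cfc_mul Real.sqrt Real.sqrt M]
  conv_rhs => rw [← cfc_id' ℝ M hsa]
  refine cfc_congr fun x hx => Real.mul_self_sqrt ?_
  have := hnn ((spectrum.algebraMap_mem_iff (S := ℂ) (r := x)).2 hx)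
  simpa using this

theorem cfc_diagonal (f : ℝ → ℝ) (r : S → ℝ) :
    cfc f (Matrix.diagonal fun i => (r i : ℂ)) = Matrix.diagonal fun i => (f (r i) : ℂ) := by
  have hsa : IsSelfAdjoint (Matrix.diagonal fun i => (r i : ℂ)) := by
    simp [IsSelfAdjoint, Matrix.star_eq_conjTranspose, Matrix.diagonal_conjTranspose]
  -- `f` agrees on the finite spectrum with its interpolating polynomial
  let p := Lagrange.interpolate (Finset.univ.image r) id f
  have hp : ∀ i, p.eval (r i) = f (r i) := fun i =>
    Lagrange.eval_interpolate_at_node f (Set.injOn_id _) (by simp : r i ∈ Finset.univ.image r)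
  have hspec : ∀ x ∈ spectrum ℝ (Matrix.diagonal fun i => (r i : ℂ)), ∃ i, r i = x := by
    intro x hx
    have := (spectrum.algebraMap_mem_iff (S := ℂ) (r := x)).2 hx
    rw [spectrum_diagonal] at this
    obtain ⟨i, hi⟩ := this
    exact ⟨i, by simpa using hi⟩
  rw [cfc_congr (g := p.eval) (fun x hx => by obtain ⟨i, rfl⟩ := hspec x hx; exact (hp i).symm),
    cfc_polynomial p _ hsa]
  have hd : (Matrix.diagonal fun i => (r i : ℂ)) =
      Matrix.diagonalAlgHom ℝ (fun i => (r i : ℂ)) := rfl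
  rw [hd, Polynomial.aeval_algHom_apply]
  ext i j
  simp only [Matrix.diagonalAlgHom_apply, Matrix.diagonal_apply]
  split_ifs with h
  · rw [Polynomial.aeval_pi_apply₂]
    have : (Polynomial.aeval (r i : ℂ)) p = ((p.eval (r i) : ℝ) : ℂ) := by
      simpa using Polynomial.aeval_algebraMap_apply ℂ (r i) p
    rw [this, hp]
  · rfl

end FunctionalCalculus

/-! ### Entropy and fidelity -/

section Fidelity

variable {E : Type} [Fintype E]

theorem exists_sq_eq_of_nonneg {z : ℂ} (hz : 0 ≤ z) : ∃ r : ℝ, 0 ≤ r ∧ z = (r ^ 2 : ℝ) := by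
  obtain ⟨h1, h2⟩ := Complex.le_def.1 hz
  refine ⟨√z.re, Real.sqrt_nonneg _, ?_⟩
  rw [Real.sq_sqrt h1]
  exact Complex.ext rfl (by simpa using h2.symm)

theorem posSemidef_ketbra (v : E → ℂ) : (ketbra v).PosSemidef :=
  Matrix.posSemidef_vecMulVec_self_star v

theorem ketbra_mul_mul_ketbra (v : E → ℂ) (σ : Matrix E E ℂ) :
    ketbra v * σ * ketbra v = (star v ⬝ᵥ σ *ᵥ v) • ketbra v := by
  rw [ketbra, Matrix.mul_assoc, Matrix.mul_vecMulVec, Matrix.vecMulVec_mul_vecMulVec,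
    Matrix.vecMulVec_smul]

theorem trace_ketbra (v : E → ℂ) : (ketbra v).trace = star v ⬝ᵥ v := by
  rw [ketbra, Matrix.trace_vecMulVec, dotProduct_comm]

variable [DecidableEq E]

theorem psdSqrt_diagonal (r : E → ℝ) :
    psdSqrt (Matrix.diagonal fun i => (r i : ℂ)) = Matrix.diagonal fun i => (√(r i) : ℂ) :=
  cfc_diagonal Real.sqrt r

theorem vonNeumannEntropy_diagonal (r : E → ℝ) :
    vonNeumannEntropy (Matrix.diagonal fun i => (r i : ℂ)) = -∑ i, r i * Real.logb 2 (r i) := by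
  simp [vonNeumannEntropy, cfc_diagonal, Matrix.trace_diagonal]

theorem fidelity_nonneg (ρ σ : Matrix E E ℂ) : 0 ≤ fidelity ρ σ :=
  (Complex.le_def.1 (posSemidef_psdSqrt _).trace_nonneg).1

/-- A dual bound for the fidelity: with `G = √(√ρ σ √ρ)`, the trace of the positive operator
`(G - τ √ρ) (√ρ)⁻¹ (G - τ √ρ)` is nonnegative. -/
theorem two_mul_fidelity_le {R σ : Matrix E E ℂ} (hR : R.PosDef) (hσ : σ.PosSemidef) {τ : ℝ}
    (hτ : 0 < τ) :
    2 * fidelity (R * R) σ ≤ τ * R.trace.re + τ⁻¹ * (σ * R).trace.re := by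
  have hRu : IsUnit R.det := (Matrix.isUnit_iff_isUnit_det R).1 hR.isUnit
  have hY : (R * σ * R).PosSemidef := by
    have := hσ.mul_mul_conjTranspose_same R
    rwa [hR.isHermitian.eq] at this
  set G := psdSqrt (R * σ * R) with hG
  have hGG : G * G = R * σ * R := psdSqrt_mul_psdSqrt hY
  have hGh : G.IsHermitian := isHermitian_psdSqrt _
  have hF : fidelity (R * R) σ = G.trace.re := by
    rw [fidelity, psdSqrt_mul_self_of_posSemidef hR.posSemidef]
  have hDh : (G - (τ : ℂ) • R)ᴴ = G - (τ : ℂ) • R := by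
    rw [Matrix.conjTranspose_sub, Matrix.conjTranspose_smul, hGh.eq, hR.isHermitian.eq]
    simp
  have hpos := (hR.inv.posSemidef.mul_mul_conjTranspose_same (G - (τ : ℂ) • R)).trace_nonneg
  rw [hDh] at hpos
  have hexp : (G - (τ : ℂ) • R) * R⁻¹ * (G - (τ : ℂ) • R) =
      G * R⁻¹ * G - (2 * τ : ℂ) • G + (τ ^ 2 : ℂ) • R := by
    simp only [sub_mul, mul_sub, smul_mul_assoc, mul_smul_comm, Matrix.mul_nonsing_inv R hRu,
      Matrix.one_mul, Matrix.nonsing_inv_mul_cancel_right R _ hRu]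
    module
  have htr : (G * R⁻¹ * G).trace = (σ * R).trace := by
    rw [Matrix.trace_mul_cycle, hGG, Matrix.mul_assoc R σ R, Matrix.trace_mul_comm,
      ← Matrix.mul_assoc, Matrix.nonsing_inv_mul R hRu, Matrix.one_mul]
  rw [hexp, Matrix.trace_add, Matrix.trace_sub, htr, Matrix.trace_smul, Matrix.trace_smul] at hpos
  have hre := (Complex.le_def.1 hpos).1
  have h2 : (0 : ℝ) ≤ (σ * R).trace.re - 2 * τ * G.trace.re + τ ^ 2 * R.trace.re := by
    have h1 : ((2 * τ : ℂ) * G.trace).re = 2 * τ * G.trace.re := by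
      rw [show (2 * τ : ℂ) = ((2 * τ : ℝ) : ℂ) by push_cast; rfl, Complex.re_ofReal_mul]
    have h3 : ((τ ^ 2 : ℂ) * R.trace).re = τ ^ 2 * R.trace.re := by
      rw [show (τ ^ 2 : ℂ) = ((τ ^ 2 : ℝ) : ℂ) by push_cast; rfl, Complex.re_ofReal_mul]
    simpa [h1, h3] using hre
  rw [hF]
  have h4 : τ * R.trace.re + τ⁻¹ * (σ * R).trace.re - 2 * G.trace.re =
      τ⁻¹ * ((σ * R).trace.re - 2 * τ * G.trace.re + τ ^ 2 * R.trace.re) := by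
    field_simp
    ring
  have := mul_nonneg (inv_nonneg.2 hτ.le) h2
  linarith

theorem ketbra_mul_ketbra (v : E → ℂ) : ketbra v * ketbra v = (star v ⬝ᵥ v) • ketbra v := by
  simpa using ketbra_mul_mul_ketbra v 1

/-- For a subnormalized pure state `|v⟩⟨v| = p |w⟩⟨w|` one has
`√p F(|w⟩⟨w|, σ) = √⟨v|σ|v⟩`; this remains true, as `0 = 0`, when `v = 0`. -/
theorem sqrt_trace_mul_fidelity_ketbra (v : E → ℂ) {σ : Matrix E E ℂ} (hσ : σ.PosSemidef) :
    √((ketbra v).trace.re) * fidelity ((((ketbra v).trace.re)⁻¹ : ℂ) • ketbra v) σ =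
      √((star v ⬝ᵥ σ *ᵥ v).re) := by
  obtain ⟨n, hn0, hn⟩ : ∃ n : ℝ, 0 ≤ n ∧ star v ⬝ᵥ v = (n ^ 2 : ℝ) :=
    exists_sq_eq_of_nonneg (dotProduct_star_self_nonneg v)
  obtain ⟨q, hq0, hq⟩ : ∃ q : ℝ, 0 ≤ q ∧ star v ⬝ᵥ σ *ᵥ v = (q ^ 2 : ℝ) :=
    exists_sq_eq_of_nonneg (hσ.dotProduct_mulVec_nonneg v)
  rw [trace_ketbra, hn, hq, Complex.ofReal_re, Complex.ofReal_re, Real.sqrt_sq hn0,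
    Real.sqrt_sq hq0]
  rcases hn0.eq_or_lt with rfl | hn1
  · have hv : v = 0 := dotProduct_star_self_eq_zero.1 (by simpa using hn)
    subst hv
    have : q = 0 := by simpa using hq.symm
    simp [this]
  have hnc : (n : ℂ) ≠ 0 := by exact_mod_cast hn1.ne'
  have hsq : ∀ c : ℝ, 0 ≤ c → psdSqrt (((n ^ 2 * c ^ 2 : ℝ) : ℂ) • ketbra v) = (c : ℂ) • ketbra v := by
    intro c hc
    refine psdSqrt_eq ((posSemidef_ketbra v).smul (by exact_mod_cast hc)) ?_
    rw [smul_mul_smul_comm, ketbra_mul_ketbra, hn, smul_smul]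
    congr 1
    push_cast
    ring
  have h1 : psdSqrt ((((n ^ 2 : ℝ) : ℂ)⁻¹) • ketbra v) = ((n⁻¹ ^ 2 : ℝ) : ℂ) • ketbra v := by
    rw [← hsq _ (by positivity)]
    congr 2
    push_cast
    field_simp
  have h2 : psdSqrt ((((n⁻¹ ^ 2 : ℝ) : ℂ) • ketbra v) * σ * (((n⁻¹ ^ 2 : ℝ) : ℂ) • ketbra v)) =
      ((q * n⁻¹ ^ 3 : ℝ) : ℂ) • ketbra v := by
    rw [← hsq (q * n⁻¹ ^ 3) (by positivity), smul_mul_assoc, smul_mul_assoc, mul_smul_comm,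
      ketbra_mul_mul_ketbra, hq, smul_smul, smul_smul]
    congr 2
    push_cast
    field_simp
  rw [fidelity, h1, h2, Matrix.trace_smul, trace_ketbra, hn, smul_eq_mul, ← Complex.ofReal_mul,
    Complex.ofReal_re]
  field_simp

end Fidelity

/-! ### Symmetric classical ensembles -/

section SymmetricEnsemble

variable {X : Type} [Fintype X] [DecidableEq X]

/-- The uniform ensemble of classical states on `X` in which, given `x`, Eve's label equals `x`
with weight `P` and each of the other labels with weight `Q`. -/
noncomputable def symmetricEnsemble (X : Type) [Fintype X] [DecidableEq X] (P Q : ℝ) (x : X) : Matrix X X ℂ :=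
  Matrix.diagonal fun j => (((if j = x then P else Q) / Fintype.card X : ℝ) : ℂ)

theorem sum_ite_eq_add (x : X) (P Q : ℝ) :
    ∑ j, (if j = x then P else Q) = P + (Fintype.card X - 1) * Q := by
  rw [← Finset.add_sum_erase _ _ (Finset.mem_univ x), if_pos rfl,
    Finset.sum_congr rfl (g := fun _ => Q) (fun j hj => if_neg (Finset.ne_of_mem_erase hj)),
    Finset.sum_const, Finset.card_erase_of_mem (Finset.mem_univ x), Finset.card_univ, nsmul_eq_mul,
    Nat.cast_pred (Fintype.card_pos_iff.2 ⟨x⟩)]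

variable {P Q : ℝ}

theorem prob_symmetricEnsemble (h : P + (Fintype.card X - 1) * Q = 1) (x : X) :
    prob (symmetricEnsemble X P Q) x = (Fintype.card X : ℝ)⁻¹ := by
  rw [prob, symmetricEnsemble, Matrix.trace_diagonal, ← Complex.ofReal_sum, Complex.ofReal_re,
    ← Finset.sum_div, sum_ite_eq_add, h, one_div]

theorem condState_symmetricEnsemble (h : P + (Fintype.card X - 1) * Q = 1) (x : X) :
    condState (symmetricEnsemble X P Q) x =
      Matrix.diagonal fun j => ((if j = x then P else Q : ℝ) : ℂ) := by
  have : Nonempty X := ⟨x⟩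
  rw [condState, prob_symmetricEnsemble h, symmetricEnsemble, ← Matrix.diagonal_smul]
  congr 1
  funext j
  have : (Fintype.card X : ℂ) ≠ 0 := by exact_mod_cast Fintype.card_ne_zero
  simp only [Pi.smul_apply, smul_eq_mul]
  push_cast
  field_simp

theorem sum_symmetricEnsemble (h : P + (Fintype.card X - 1) * Q = 1) :
    ∑ x, symmetricEnsemble X P Q x =
      Matrix.diagonal fun _ => (((Fintype.card X : ℝ)⁻¹ : ℝ) : ℂ) := by
  ext i j
  simp only [symmetricEnsemble, Matrix.sum_apply, Matrix.diagonal_apply]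
  split_ifs with hij
  · rw [← Complex.ofReal_sum, ← Finset.sum_div]
    simp only [eq_comm (a := i)]
    rw [sum_ite_eq_add, h, one_div]
  · simp

theorem condEntropy_symmetricEnsemble [Nonempty X] (h : P + (Fintype.card X - 1) * Q = 1)
    (hcard : 2 ≤ Fintype.card X) (hQ : 0 < Q) :
    condEntropy (symmetricEnsemble X P Q) =
      binaryEntropy P + (1 - P) * Real.logb 2 (Fintype.card X - 1) := by
  have hc : (2 : ℝ) ≤ Fintype.card X := by exact_mod_cast hcard
  have hS : ∀ x, vonNeumannEntropy (condState (symmetricEnsemble X P Q) x) =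
      binaryEntropy P + (1 - P) * Real.logb 2 (Fintype.card X - 1) := by
    intro x
    rw [condState_symmetricEnsemble h, vonNeumannEntropy_diagonal]
    simp only [apply_ite (Real.logb 2), ite_mul_ite]
    rw [sum_ite_eq_add, binaryEntropy, show 1 - P = (Fintype.card X - 1) * Q by linarith,
      Real.logb_mul (by linarith) hQ.ne']
    ring
  rw [condEntropy, sum_symmetricEnsemble h, vonNeumannEntropy_diagonal]
  simp only [hS, prob_symmetricEnsemble h, Finset.sum_const, Finset.card_univ, nsmul_eq_mul]
  field_simp
  ring

/-- The maximum over `σ` is attained at the maximally mixed state: the dual bound for the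
fidelity, applied with `√ρ_x` scaled by `1 / √|X|`, depends on `σ` only through its trace, because
the operators `√ρ_x` sum to a multiple of the identity. -/
theorem secrecy_symmetricEnsemble [Nonempty X] (h : P + (Fintype.card X - 1) * Q = 1)
    (hP : 0 < P) (hQ : 0 < Q) :
    secrecy (symmetricEnsemble X P Q) = (√P + (Fintype.card X - 1) * √Q) ^ 2 := by
  set c := (Fintype.card X : ℝ) with hc
  have hc0 : 0 < c := Nat.cast_pos.2 Fintype.card_pos
  set T := √P + (c - 1) * √Q with hT
  set R : X → Matrix X X ℂ := fun x => Matrix.diagonal fun j => ((if j = x then √P else √Q : ℝ) : ℂ)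
    with hR
  have hRR : ∀ x, condState (symmetricEnsemble X P Q) x = R x * R x := by
    intro x
    rw [condState_symmetricEnsemble h, hR, Matrix.diagonal_mul_diagonal]
    congr 1
    funext j
    split_ifs <;> simp [← Complex.ofReal_mul, Real.mul_self_sqrt, hP.le, hQ.le]
  have hRpos : ∀ x, (R x).PosDef := by
    intro x
    refine Matrix.PosDef.diagonal fun j => ?_
    split_ifs <;> simpa
  have hRtr : ∀ x, (R x).trace.re = T := by
    intro x
    rw [Matrix.trace_diagonal, ← Complex.ofReal_sum, Complex.ofReal_re, sum_ite_eq_add]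
  have hRsum : ∑ x, R x = (T : ℂ) • (1 : Matrix X X ℂ) := by
    ext i j
    simp only [hR, Matrix.sum_apply, Matrix.diagonal_apply, Matrix.smul_apply, Matrix.one_apply]
    split_ifs with hij
    · rw [← Complex.ofReal_sum]
      simp only [eq_comm (a := i)]
      rw [sum_ite_eq_add]
      simp [hT, hc]
    · simp
  have hs0 : 0 < √c := Real.sqrt_pos.2 hc0
  have hss : √c * √c = c := Real.mul_self_sqrt hc0.le
  have hsum : ∀ σ : Matrix X X ℂ,
      ∑ x, √(prob (symmetricEnsemble X P Q) x) *
        fidelity (condState (symmetricEnsemble X P Q) x) σ =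
      (√c)⁻¹ * ∑ x, fidelity (R x * R x) σ := by
    intro σ
    simp only [prob_symmetricEnsemble h, hRR, Finset.mul_sum, Real.sqrt_inv, ← hc]
  refine IsGreatest.csSup_eq ⟨⟨(c⁻¹ : ℂ) • 1, ⟨?_, ?_⟩, ?_⟩, ?_⟩
  · exact Matrix.PosSemidef.one.smul (by exact_mod_cast (inv_pos.2 hc0).le)
  · rw [Matrix.trace_smul, Matrix.trace_one, smul_eq_mul, hc]
    push_cast
    exact inv_mul_cancel₀ (by exact_mod_cast Fintype.card_ne_zero)
  · rw [hsum]
    have hF : ∀ x, fidelity (R x * R x) ((c⁻¹ : ℂ) • 1) = (√c)⁻¹ * T := by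
      intro x
      rw [fidelity, psdSqrt_mul_self_of_posSemidef (hRpos x).posSemidef,
        psdSqrt_eq (R := (((√c)⁻¹ : ℝ) : ℂ) • R x), Matrix.trace_smul, smul_eq_mul,
        Complex.re_ofReal_mul, hRtr]
      · exact (hRpos x).posSemidef.smul (by exact_mod_cast (inv_pos.2 hs0).le)
      · rw [show R x * (c⁻¹ : ℂ) • 1 * R x = (c⁻¹ : ℂ) • (R x * R x) by simp, smul_mul_smul_comm,
          ← Complex.ofReal_mul,
          ← mul_inv, hss, Complex.ofReal_inv]
    simp only [hF, Finset.sum_const, Finset.card_univ, nsmul_eq_mul, ← hc]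
    rw [show (√c)⁻¹ * (c * ((√c)⁻¹ * T)) = c / (√c * √c) * T by field_simp, hss,
      div_self hc0.ne', one_mul]
  · rintro r ⟨σ, ⟨hσ, hσ1⟩, rfl⟩
    rw [hsum]
    refine pow_le_pow_left₀ (mul_nonneg (inv_nonneg.2 hs0.le)
      (Finset.sum_nonneg fun x _ => fidelity_nonneg _ _)) ?_ 2
    have hb := Finset.sum_le_sum fun x (_ : x ∈ Finset.univ) =>
      two_mul_fidelity_le (hRpos x) hσ (inv_pos.2 hs0)
    have htr : ∑ x, (σ * R x).trace.re = T := by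
      rw [← Complex.re_sum, ← Matrix.trace_sum, ← Finset.mul_sum, hRsum, mul_smul_comm, mul_one,
        Matrix.trace_smul, hσ1]
      simp
    rw [← Finset.mul_sum, Finset.sum_add_distrib, ← Finset.mul_sum, ← Finset.mul_sum, htr] at hb
    simp only [hRtr, Finset.sum_const, Finset.card_univ, nsmul_eq_mul, ← hc, inv_inv] at hb
    rw [show (√c)⁻¹ * (c * T) = √c * T by
      rw [inv_mul_eq_iff_eq_mul₀ hs0.ne', ← mul_assoc, hss]] at hb
    rw [inv_mul_le_iff₀ hs0]
    linarith

end SymmetricEnsemble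

/-! ### Measurements on purifications -/

section Purification

variable {S E : Type}

/-- The coefficients of `Φ` as a matrix `B` from the measured system to Eve's: if the system is
projected onto `|w⟩`, Eve is left with the subnormalized vector `B w̄`, and her reduced state is
`B Bᴴ`. -/
def coeffMatrix (Φ : S × E → ℂ) : Matrix E S ℂ :=
  Matrix.of fun e s => Φ (s, e)

theorem coeffMatrix_conjTranspose_mul [Fintype E] (Φ : S × E → ℂ) :
    (coeffMatrix Φ)ᴴ * coeffMatrix Φ = (traceSnd (ketbra Φ))ᵀ := by
  ext s t
  simp [coeffMatrix, Matrix.mul_apply, traceSnd, ketbra, Matrix.vecMulVec_apply, mul_comm]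

theorem dotProduct_star_mulVec_eq_trace [Fintype E] (v : E → ℂ) (σ : Matrix E E ℂ) :
    star v ⬝ᵥ σ *ᵥ v = (σ * ketbra v).trace := by
  rw [ketbra, Matrix.mul_vecMulVec, Matrix.trace_vecMulVec, dotProduct_comm]

variable [Fintype S]

theorem sum_ketbra_orthonormalBasis [DecidableEq S]
    (b : OrthonormalBasis S ℂ (EuclideanSpace ℂ S)) :
    ∑ x, ketbra (star fun i => b x i) = 1 := by
  ext s t
  have h := b.sum_inner_mul_inner (EuclideanSpace.single t 1) (EuclideanSpace.single s 1)
  simp only [EuclideanSpace.inner_single_left, EuclideanSpace.inner_single_right] at h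
  simp only [Matrix.sum_apply, ketbra, Matrix.vecMulVec_apply, Matrix.one_apply, Pi.star_apply,
    star_star]
  simp at h
  simp only [mul_comm (star _)]
  simpa [eq_comm] using h

theorem sum_ketbra_coeffMatrix [DecidableEq S]
    (b : OrthonormalBasis S ℂ (EuclideanSpace ℂ S)) (Φ : S × E → ℂ) :
    ∑ x, ketbra (coeffMatrix Φ *ᵥ star fun i => b x i) = coeffMatrix Φ * (coeffMatrix Φ)ᴴ := by
  have h : ∀ w : S → ℂ, ketbra (coeffMatrix Φ *ᵥ w) =
      coeffMatrix Φ * ketbra w * (coeffMatrix Φ)ᴴ := by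
    intro w
    rw [ketbra, ketbra, Matrix.mul_vecMulVec, Matrix.vecMulVec_mul, Matrix.star_mulVec]
  simp only [h]
  rw [← Matrix.sum_mul, ← Matrix.mul_sum, sum_ketbra_orthonormalBasis, Matrix.mul_one]

variable [Fintype E] [DecidableEq E]

theorem traceFst_kronecker_one_mul_ketbra (P : Matrix S S ℂ) (Φ : S × E → ℂ) (e f : E) :
    traceFst ((P ⊗ₖ (1 : Matrix E E ℂ)) * ketbra Φ) e f =
      ∑ s, ∑ u, P s u * Φ (u, e) * star (Φ (s, f)) := by
  simp [traceFst, ketbra, Matrix.mul_apply, Matrix.vecMulVec_apply, Fintype.sum_prod_type,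
    Matrix.one_apply, mul_assoc]

theorem traceFst_ketbra_kronecker_one_mul_ketbra (w : S → ℂ) (Φ : S × E → ℂ) :
    traceFst ((ketbra w ⊗ₖ (1 : Matrix E E ℂ)) * ketbra Φ) =
      ketbra (coeffMatrix Φ *ᵥ star w) := by
  ext e f
  rw [traceFst_kronecker_one_mul_ketbra]
  simp only [ketbra, Matrix.vecMulVec_apply, Matrix.mulVec, dotProduct, coeffMatrix,
    Matrix.of_apply, Pi.star_apply, star_sum, star_mul', star_star, Finset.sum_mul_sum]
  rw [Finset.sum_comm]
  exact Finset.sum_congr rfl fun s _ => Finset.sum_congr rfl fun u _ => by ring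

/-- An upper bound for the eigenvalues of `Bᴴ B` also bounds those of `B Bᴴ`:
`c (c - B Bᴴ) = (c - B Bᴴ)² + B (c - Bᴴ B) Bᴴ`. -/
theorem posSemidef_smul_one_sub_mul_conjTranspose [DecidableEq S] {B : Matrix E S ℂ}
    {c : ℝ} (hc : 0 < c) (h : ((c : ℂ) • 1 - Bᴴ * B).PosSemidef) :
    ((c : ℂ) • 1 - B * Bᴴ).PosSemidef := by
  have h1 : ((c : ℂ) • 1 - B * Bᴴ)ᴴ = (c : ℂ) • 1 - B * Bᴴ := by
    simp [Matrix.conjTranspose_sub, Matrix.conjTranspose_smul]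
  have h2 := Matrix.posSemidef_self_mul_conjTranspose ((c : ℂ) • 1 - B * Bᴴ)
  rw [h1] at h2
  have h3 := (h2.add (h.mul_mul_conjTranspose_same B)).smul
    (show (0 : ℂ) ≤ (c : ℂ)⁻¹ by exact_mod_cast (inv_pos.2 hc).le)
  have hc' : (c : ℂ) ≠ 0 := by exact_mod_cast hc.ne'
  convert h3 using 1
  rw [eq_inv_smul_iff₀ hc']
  simp only [sub_mul, mul_sub, smul_mul_assoc, mul_smul_comm, Matrix.one_mul, Matrix.mul_one,
    Matrix.mul_smul, Matrix.smul_mul, ← Matrix.mul_assoc, Matrix.sub_mul, Matrix.mul_sub]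
  module

theorem trace_mul_nonneg {σ D : Matrix E E ℂ} (hσ : σ.PosSemidef) (hD : D.PosSemidef) :
    0 ≤ (σ * D).trace := by
  have h := (hD.mul_mul_conjTranspose_same (psdSqrt σ)).trace_nonneg
  rwa [(isHermitian_psdSqrt σ).eq, Matrix.trace_mul_cycle, psdSqrt_mul_psdSqrt hσ] at h

/-- Eve's conditional states are pure, so the fidelities in `secrecy` are expectation values. -/
theorem sum_sqrt_prob_mul_fidelity_basisEnsemble (b : OrthonormalBasis S ℂ (EuclideanSpace ℂ S))
    (Φ : S × E → ℂ) {σ : Matrix E E ℂ} (hσ : σ.PosSemidef) :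
    ∑ x, √(prob (basisEnsemble b Φ) x) * fidelity (condState (basisEnsemble b Φ) x) σ =
      ∑ x, √((star (coeffMatrix Φ *ᵥ star fun i => b x i) ⬝ᵥ
        σ *ᵥ (coeffMatrix Φ *ᵥ star fun i => b x i)).re) := by
  refine Finset.sum_congr rfl fun x _ => ?_
  rw [← sqrt_trace_mul_fidelity_ketbra _ hσ, condState, prob, basisEnsemble,
    traceFst_ketbra_kronecker_one_mul_ketbra]

variable [DecidableEq S]

/-- By the Cauchy-Schwarz inequality `p_secr` is at most `|S|` times the largest eigenvalue of
Eve's reduced state, which is that of the measured state. -/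
theorem sq_sum_sqrt_prob_mul_fidelity_basisEnsemble_le
    (b : OrthonormalBasis S ℂ (EuclideanSpace ℂ S)) {Φ : S × E → ℂ} {c : ℝ} (hc : 0 < c)
    (hΦ : ((c : ℂ) • 1 - traceSnd (ketbra Φ)).PosSemidef) {σ : Matrix E E ℂ} (hσ : IsState σ) :
    (∑ x, √(prob (basisEnsemble b Φ) x) * fidelity (condState (basisEnsemble b Φ) x) σ) ^ 2 ≤
      Fintype.card S * c := by
  have hB : ((c : ℂ) • 1 - (coeffMatrix Φ)ᴴ * coeffMatrix Φ).PosSemidef := by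
    rw [coeffMatrix_conjTranspose_mul]
    simpa using hΦ.transpose
  have htr := (Complex.le_def.1 (trace_mul_nonneg hσ.1
    (posSemidef_smul_one_sub_mul_conjTranspose hc hB))).1
  rw [mul_sub, Matrix.trace_sub, mul_smul_comm, mul_one, Matrix.trace_smul, hσ.2,
    ← sum_ketbra_coeffMatrix b Φ, Finset.mul_sum, Matrix.trace_sum] at htr
  simp only [← dotProduct_star_mulVec_eq_trace, Complex.sub_re, Complex.re_sum] at htr
  rw [sum_sqrt_prob_mul_fidelity_basisEnsemble b Φ hσ.1]
  refine sq_sum_le_card_mul_sum_sq.trans ?_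
  rw [Finset.card_univ]
  refine mul_le_mul_of_nonneg_left ?_ (Nat.cast_nonneg _)
  rw [Finset.sum_congr rfl fun x _ => Real.sq_sqrt
    (Complex.le_def.1 (hσ.1.dotProduct_mulVec_nonneg _)).1]
  simpa using htr

end Purification

/-! ### The noisy unbiased state -/

section NoisyState

variable {d : ℕ} {ε : ℝ}

theorem inv_sqrt_mul_inv_sqrt_natCast (d : ℕ) : (√(d : ℝ))⁻¹ * (√(d : ℝ))⁻¹ = (d : ℝ)⁻¹ := by
  rw [← mul_inv, Real.mul_self_sqrt (Nat.cast_nonneg d)]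

theorem ketbra_unbiased_apply (s t : Fin d) : ketbra (unbiased d) s t = (d : ℂ)⁻¹ := by
  simp only [ketbra, unbiased, Matrix.vecMulVec_apply, Pi.star_apply, Complex.star_def,
    Complex.conj_ofReal]
  rw [← Complex.ofReal_mul, inv_sqrt_mul_inv_sqrt_natCast]
  simp

theorem dotProduct_unbiased (hd : d ≠ 0) : star (unbiased d) ⬝ᵥ unbiased d = 1 := by
  rw [← trace_ketbra]
  simp [Matrix.trace, ketbra_unbiased_apply, hd]

theorem noisyState_eq (hd : d ≠ 0) :
    noisyState d ε = ((1 - ε : ℝ) : ℂ) • ketbra (unbiased d) + ((ε / d : ℝ) : ℂ) • 1 := by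
  rw [noisyState, depolarize, trace_ketbra, dotProduct_unbiased hd, mul_one]

/-- The largest eigenvalue of the noisy state is at most `1 - ε + ε / d`. -/
theorem posSemidef_smul_one_sub_noisyState (hd : d ≠ 0) (hε : ε ≤ 1) :
    (((1 - ε + ε / d : ℝ) : ℂ) • 1 - noisyState d ε).PosSemidef := by
  have h : ((1 : Matrix (Fin d) (Fin d) ℂ) - ketbra (unbiased d)).PosSemidef := by
    have hh : (1 - ketbra (unbiased d))ᴴ = 1 - ketbra (unbiased d) := by
      rw [Matrix.conjTranspose_sub, (posSemidef_ketbra _).1.eq, Matrix.conjTranspose_one]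
    have h2 := Matrix.posSemidef_self_mul_conjTranspose (1 - ketbra (unbiased d))
    rw [hh] at h2
    convert h2 using 1
    rw [sub_mul, mul_sub, mul_sub, ketbra_mul_ketbra, dotProduct_unbiased hd]
    simp
  convert h.smul (show (0 : ℂ) ≤ ((1 - ε : ℝ) : ℂ) by exact_mod_cast sub_nonneg.2 hε) using 1
  rw [noisyState_eq hd]
  push_cast
  module

theorem sum_noisyState_apply (hd : d ≠ 0) (x : Fin d) :
    ∑ s, noisyState d ε s x = ((1 - ε + ε / d : ℝ) : ℂ) := by
  have hd' : (d : ℂ) ≠ 0 := by exact_mod_cast hd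
  rw [noisyState_eq hd]
  simp only [Matrix.add_apply, Matrix.smul_apply, ketbra_unbiased_apply, Matrix.one_apply,
    Finset.sum_add_distrib, smul_eq_mul, Finset.sum_const, Finset.card_univ, Fintype.card_fin,
    nsmul_eq_mul, mul_ite, mul_one, mul_zero, Finset.sum_ite_eq', Finset.mem_univ, if_true]
  push_cast
  field_simp

/-- The computational basis is unbiased to the top eigenvector of the noisy state, so Eve's optimal
state is the pure top eigenstate of her marginal and all the fidelities are equal. -/
theorem exists_state_sq_sum_sqrt_prob_mul_fidelity_eq {E : Type} [Fintype E] [DecidableEq E]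
    (hd : d ≠ 0) (hε₀ : 0 < ε) (hε₁ : ε < 1) {Φ : Fin d × E → ℂ}
    (hΦ : traceSnd (ketbra Φ) = noisyState d ε) :
    ∃ σ : Matrix E E ℂ, IsState σ ∧
      (d : ℝ) * (1 - ε + ε / d) =
        (∑ x, √(prob (basisEnsemble (EuclideanSpace.basisFun (Fin d) ℂ) Φ) x) *
          fidelity (condState (basisEnsemble (EuclideanSpace.basisFun (Fin d) ℂ) Φ) x) σ) ^ 2 := by
  have hd0 : (0 : ℝ) < d := by exact_mod_cast Nat.pos_of_ne_zero hd
  set c := 1 - ε + ε / d with hc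
  have hc0 : 0 < c := add_pos (sub_pos.2 hε₁) (div_pos hε₀ hd0)
  have hdc : 0 < d * c := mul_pos hd0 hc0
  set e : Fin d → E → ℂ := fun x f => Φ (x, f) with he
  have hvec : ∀ x, (coeffMatrix Φ *ᵥ star fun i => (EuclideanSpace.basisFun (Fin d) ℂ) x i) = e x := by
    intro x
    ext f
    simp [Matrix.mulVec, dotProduct, coeffMatrix, EuclideanSpace.basisFun_apply, he,
      apply_ite (starRingEnd ℂ)]
  set u : E → ℂ := (((√(d * c))⁻¹ : ℝ) : ℂ) • ∑ s, e s with hu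
  have hinner : ∀ x, star (e x) ⬝ᵥ ∑ s, e s = (c : ℂ) := by
    intro x
    rw [dotProduct_sum, ← sum_noisyState_apply hd x, ← hΦ]
    refine Finset.sum_congr rfl fun s _ => ?_
    simp [dotProduct, he, traceSnd, ketbra, Matrix.vecMulVec_apply, mul_comm]
  have hsq : (√(d * c))⁻¹ * (√(d * c))⁻¹ = (d * c)⁻¹ := by
    rw [← mul_inv, Real.mul_self_sqrt hdc.le]
  have hunit : star u ⬝ᵥ u = 1 := by
    rw [hu, star_smul, smul_dotProduct, dotProduct_smul, star_sum, sum_dotProduct]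
    simp only [hinner, Finset.sum_const, Finset.card_univ, Fintype.card_fin, nsmul_eq_mul,
      Complex.star_def, Complex.conj_ofReal, smul_eq_mul]
    rw [← mul_assoc, ← Complex.ofReal_mul, hsq]
    norm_cast
    exact inv_mul_cancel₀ hdc.ne'
  have hval : ∀ x, star (e x) ⬝ᵥ ketbra u *ᵥ e x = ((c / d : ℝ) : ℂ) := by
    intro x
    have h1 : star (e x) ⬝ᵥ u = (((√(d * c))⁻¹ * c : ℝ) : ℂ) := by
      rw [hu, dotProduct_smul, hinner, smul_eq_mul, Complex.ofReal_mul]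
    have h2 : star u ⬝ᵥ e x = (((√(d * c))⁻¹ * c : ℝ) : ℂ) := by
      rw [Matrix.star_dotProduct, h1]
      simp
    rw [ketbra, Matrix.vecMulVec_mulVec, dotProduct_smul, h1, h2]
    simp only [MulOpposite.smul_eq_mul_unop, MulOpposite.unop_op]
    rw [← Complex.ofReal_mul, mul_mul_mul_comm, hsq]
    congr 1
    field_simp
  refine ⟨ketbra u, ⟨posSemidef_ketbra u, by rw [trace_ketbra, hunit]⟩, ?_⟩
  rw [sum_sqrt_prob_mul_fidelity_basisEnsemble _ _ (posSemidef_ketbra u)]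
  simp only [hvec, hval, Complex.ofReal_re, Finset.sum_const, Finset.card_univ, Fintype.card_fin,
    nsmul_eq_mul]
  rw [mul_pow, Real.sq_sqrt (div_nonneg hc0.le hd0.le)]
  field_simp

theorem isGreatest_basisMaxEntropies {E : Type} [Fintype E] [DecidableEq E]
    (hd : d ≠ 0) (hε₀ : 0 < ε) (hε₁ : ε < 1) {Φ : Fin d × E → ℂ}
    (hΦ : traceSnd (ketbra Φ) = noisyState d ε) :
    IsGreatest (basisMaxEntropies Φ) (Real.logb 2 (d - (d - 1) * ε)) := by
  have hd1 : (1 : ℝ) ≤ d := by exact_mod_cast Nat.one_le_iff_ne_zero.2 hd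
  have hd0 : (0 : ℝ) < d := by linarith
  have hc0 : 0 < 1 - ε + ε / d := add_pos (sub_pos.2 hε₁) (div_pos hε₀ hd0)
  have hval : (d : ℝ) - (d - 1) * ε = d * (1 - ε + ε / d) := by
    field_simp
    ring
  have hbound : ∀ (b : OrthonormalBasis (Fin d) ℂ (EuclideanSpace ℂ (Fin d))), ∀ r ∈
      {r : ℝ | ∃ σ : Matrix E E ℂ, IsState σ ∧ r = (∑ x, √(prob (basisEnsemble b Φ) x) *
        fidelity (condState (basisEnsemble b Φ) x) σ) ^ 2}, r ≤ d * (1 - ε + ε / d) := by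
    rintro b r ⟨σ, hσ, rfl⟩
    have h := sq_sum_sqrt_prob_mul_fidelity_basisEnsemble_le b hc0
      (hΦ ▸ posSemidef_smul_one_sub_noisyState hd hε₁.le) hσ
    rwa [Fintype.card_fin] at h
  rw [hval]
  constructor
  · refine ⟨EuclideanSpace.basisFun (Fin d) ℂ, ?_⟩
    have h : secrecy (basisEnsemble (EuclideanSpace.basisFun (Fin d) ℂ) Φ) =
        d * (1 - ε + ε / d) :=
      IsGreatest.csSup_eq
        ⟨exists_state_sq_sum_sqrt_prob_mul_fidelity_eq hd hε₀ hε₁ hΦ, hbound _⟩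
    exact congrArg (Real.logb 2) h.symm
  · rintro _ ⟨b, rfl⟩
    have hle : secrecy (basisEnsemble b Φ) ≤ d * (1 - ε + ε / d) :=
      Real.sSup_le (hbound b) (mul_pos hd0 hc0).le
    have h0 : 0 ≤ secrecy (basisEnsemble b Φ) := by
      refine Real.sSup_nonneg ?_
      rintro _ ⟨σ, -, rfl⟩
      exact sq_nonneg _
    rcases h0.eq_or_lt with h0 | h0
    · -- `logb 2 0 = 0` is harmless because the bound exceeds one
      rw [condMaxEntropy, ← h0, Real.logb_zero]
      refine Real.logb_nonneg one_lt_two ?_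
      rw [← hval]
      nlinarith
    · exact Real.logb_le_logb_of_le one_lt_two h0 hle

end NoisyState

/-! ### The square-root decomposition -/

section SqrtDecomp

variable {d : ℕ} {ε : ℝ}

/-- The eigenvalue `√(1 - ε + ε / d)` of `√M_x` on `|x⟩`. -/
noncomputable def eigTop (d : ℕ) (ε : ℝ) : ℝ := √(1 - ε + ε / d)

/-- The eigenvalue `√(ε / d)` of `√M_x` on the complement of `|x⟩`. -/
noncomputable def eigBot (d : ℕ) (ε : ℝ) : ℝ := √(ε / d)

theorem eigBot_sq (hε₀ : 0 < ε) : eigBot d ε ^ 2 = ε / d :=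
  Real.sq_sqrt (by positivity)

theorem eigTop_sq (hε₀ : 0 < ε) (hε₁ : ε < 1) : eigTop d ε ^ 2 = 1 - ε + ε / d :=
  Real.sq_sqrt (add_nonneg (sub_nonneg.2 hε₁.le) (by positivity))

theorem eigBot_pos (hd : 2 ≤ d) (hε₀ : 0 < ε) : 0 < eigBot d ε := by
  have : (0 : ℝ) < d := by exact_mod_cast (by omega : 0 < d)
  exact Real.sqrt_pos.2 (by positivity)

theorem eigBot_lt_eigTop (hε₀ : 0 < ε) (hε₁ : ε < 1) : eigBot d ε < eigTop d ε :=
  Real.sqrt_lt_sqrt (by positivity) (by linarith)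

theorem noisyMeas_eq (x : Fin d) :
    noisyMeas d ε x =
      Matrix.diagonal fun s => ((if s = x then 1 - ε + ε / d else ε / d : ℝ) : ℂ) := by
  have htr : (ketbra (ket x)).trace = 1 := by simp [trace_ketbra, ket]
  ext s t
  rw [noisyMeas, depolarize, htr]
  simp only [Matrix.add_apply, Matrix.smul_apply, ketbra, ket, Matrix.vecMulVec_apply,
    Pi.star_apply, Pi.single_apply, Matrix.one_apply, Matrix.diagonal_apply, smul_eq_mul]
  by_cases hst : s = t
  · subst hst
    by_cases hs : s = x <;> simp [hs]
  · by_cases hs : s = x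
    · have : t ≠ x := fun h => hst (hs.trans h.symm)
      simp [hst, this]
    · simp [hst, hs]

theorem psdSqrt_noisyMeas (x : Fin d) :
    psdSqrt (noisyMeas d ε x) =
      Matrix.diagonal fun s => ((if s = x then eigTop d ε else eigBot d ε : ℝ) : ℂ) := by
  rw [noisyMeas_eq, psdSqrt_diagonal]
  simp only [apply_ite Real.sqrt, eigTop, eigBot]

theorem pStar_eq (k : Fin d) : pStar d ε k = (eigTop d ε + (d - 1) * eigBot d ε) ^ 2 / d := by
  rw [pStar, psdSqrt_noisyMeas, Matrix.trace_diagonal, ← Complex.ofReal_sum, Complex.ofReal_re,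
    sum_ite_eq_add, Fintype.card_fin]

theorem ketbra_ofReal_apply {I : Type} (f : I → ℝ) (s t : I) :
    ketbra (fun i => (f i : ℂ)) s t = ((f s * f t : ℝ) : ℂ) := by
  simp [ketbra, Matrix.vecMulVec_apply]

theorem projNe_apply (x s t : Fin d) :
    projNe x s t = ((if s = t then if s = x then 0 else 1 else 0 : ℝ) : ℂ) := by
  simp only [projNe, ketbra, ket, Matrix.sub_apply, Matrix.one_apply, Matrix.vecMulVec_apply,
    Pi.star_apply, Pi.single_apply]
  by_cases hst : s = t
  · subst hst
    by_cases hs : s = x <;> simp [hs]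
  · by_cases hs : s = x
    · have : t ≠ x := fun h => hst (hs.trans h.symm)
      simp [hst, this]
    · simp [hst, hs]

theorem projNe_eq_diagonal (x : Fin d) :
    projNe x = Matrix.diagonal fun s => ((if s = x then 0 else 1 : ℝ) : ℂ) := by
  ext s t
  rw [projNe_apply, Matrix.diagonal_apply]
  split_ifs <;> simp

theorem unbiasedNe_eq (x : Fin d) :
    unbiasedNe d x =
      fun s => ((√((d : ℝ) / (d - 1)) * (if s = x then 0 else (√(d : ℝ))⁻¹) : ℝ) : ℂ) := by
  funext s
  rw [unbiasedNe, projNe_eq_diagonal, Pi.smul_apply, Matrix.mulVec_diagonal]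
  by_cases hs : s = x <;> simp [hs, unbiased]

theorem ketbra_unbiasedNe_apply (hd : 2 ≤ d) (x s t : Fin d) :
    ketbra (unbiasedNe d x) s t =
      ((if s = x then 0 else if t = x then 0 else ((d : ℝ) - 1)⁻¹ : ℝ) : ℂ) := by
  have hd2 : (2 : ℝ) ≤ d := by exact_mod_cast hd
  rw [unbiasedNe_eq, ketbra_ofReal_apply]
  congr 1
  split_ifs
  · simp
  · simp
  · simp
  · rw [mul_mul_mul_comm, inv_sqrt_mul_inv_sqrt_natCast, Real.mul_self_sqrt
      (div_nonneg (by linarith) (by linarith))]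
    field_simp

/-- The difference between the matrix entries of `d K_{x,x}` and those of
`|v⟩⟨v|`, `|v⟩ = (a - b)|x⟩`, where `a` and `b` are the eigenvalues of `√M_x`. -/
def diagCorrection (d : ℕ) (a b : ℝ) (x s t : Fin d) : ℝ :=
  if s = x then if t = x then a ^ 2 - (a - b) ^ 2 else a * b
  else if t = x then a * b else if s = t then (d - 1) * b ^ 2 else 0

/-- The matrix entries of `d K_{x,j}`: those of `|v⟩⟨v|` with `|v⟩ = a|x⟩ - b|j⟩`, where `a` and `b`
are the eigenvalues of `√M_x`, with a correction for `x = j`. -/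
theorem sqrtDecomp_apply (hd : 2 ≤ d) (hε₀ : 0 < ε) (x j s t : Fin d) :
    sqrtDecomp d ε x j s t =
      (((d : ℝ)⁻¹ * (((if s = x then eigTop d ε else 0) - (if s = j then eigBot d ε else 0)) *
        ((if t = x then eigTop d ε else 0) - (if t = j then eigBot d ε else 0)) +
        if j = x then diagCorrection d (eigTop d ε) (eigBot d ε) x s t else 0) : ℝ) : ℂ) := by
  have hd2 : (2 : ℝ) ≤ d := by exact_mod_cast hd
  have hd1 : (d : ℝ) - 1 ≠ 0 := by linarith
  have hb := eigBot_sq (d := d) hε₀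
  have hss := inv_sqrt_mul_inv_sqrt_natCast d
  rw [sqrtDecomp]
  by_cases hxj : x = j
  · subst hxj
    have hv : psdSqrt (noisyMeas d ε x) *ᵥ unbiased d =
        fun s => (((if s = x then eigTop d ε else eigBot d ε) * (√(d : ℝ))⁻¹ : ℝ) : ℂ) := by
      funext s
      rw [psdSqrt_noisyMeas, Matrix.mulVec_diagonal, unbiased, ← Complex.ofReal_mul]
    rw [if_pos rfl, if_pos rfl, Matrix.add_apply, Matrix.smul_apply, Matrix.sub_apply, hv,
      ketbra_ofReal_apply, projNe_apply, ketbra_unbiasedNe_apply hd, smul_eq_mul,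
      ← Complex.ofReal_sub, ← Complex.ofReal_mul, ← Complex.ofReal_add, mul_mul_mul_comm, hss]
    congr 1
    have hbε : ((d : ℝ) - 1) * ε / d ^ 2 = (d : ℝ)⁻¹ * ((d - 1) * eigBot d ε ^ 2) := by
      rw [hb]
      field_simp
    rw [hbε, diagCorrection]
    by_cases hs : s = x
    · by_cases ht : t = x
      · simp [hs, ht]
        ring
      · simp [hs, ht, Ne.symm ht]
        ring
    · by_cases ht : t = x
      · simp [hs, ht]
        ring
      · by_cases hst : s = t
        · subst hst
          simp [hs]
          field_simp
          ring
        · simp [hs, ht, hst]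
          field_simp
          ring
  · have hv : psdSqrt (noisyMeas d ε x) *ᵥ (unbiased d j • ket x - unbiased d x • ket j) =
        fun s => ((((if s = x then eigTop d ε else 0) - (if s = j then eigBot d ε else 0)) *
          (√(d : ℝ))⁻¹ : ℝ) : ℂ) := by
      funext s
      rw [psdSqrt_noisyMeas, Matrix.mulVec_diagonal]
      simp only [unbiased, ket, Pi.sub_apply, Pi.smul_apply, Pi.single_apply, smul_eq_mul]
      by_cases hs : s = x
      · have : s ≠ j := fun h => hxj (hs.symm.trans h)
        subst hs
        simp [hxj]
      · by_cases hj : s = j <;> simp [hs, hj, Ne.symm hxj]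
    rw [if_neg hxj, if_neg (Ne.symm hxj), hv, ketbra_ofReal_apply, mul_mul_mul_comm, hss]
    congr 1
    ring

theorem sum_sqrtDecomp_fst (hd : 2 ≤ d) (hε₀ : 0 < ε) (hε₁ : ε < 1) (j : Fin d) :
    ∑ x, sqrtDecomp d ε x j = ((d : ℂ)⁻¹) • 1 := by
  have hd0 : (d : ℂ) ≠ 0 := by exact_mod_cast (by omega : d ≠ 0)
  have hdd : (d : ℂ)⁻¹ * d = 1 := inv_mul_cancel₀ hd0
  have hb : (eigBot d ε : ℂ) ^ 2 = ε / d := by exact_mod_cast eigBot_sq hε₀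
  have ha : (eigTop d ε : ℂ) ^ 2 = 1 - ε + ε / d := by exact_mod_cast eigTop_sq hε₀ hε₁
  have hab : (eigTop d ε : ℂ) ^ 2 + (d - 1) * (eigBot d ε : ℂ) ^ 2 = 1 := by
    rw [ha, hb]
    field_simp
    ring
  ext s t
  rw [Matrix.sum_apply]
  simp only [sqrtDecomp_apply hd hε₀]
  rw [← Complex.ofReal_sum, ← Finset.mul_sum, Finset.sum_add_distrib]
  simp only [Matrix.smul_apply, Matrix.one_apply, sub_mul, mul_sub, Finset.sum_sub_distrib,
    Finset.sum_ite_eq, Finset.mem_univ, if_true, diagCorrection]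
  by_cases hst : s = t
  · subst hst
    by_cases hs : s = j
    · simp [hs]
      linear_combination (d : ℂ)⁻¹ * hab
    · simp [hs]
      linear_combination (d : ℂ)⁻¹ * hab
  · by_cases hs : s = j
    · have ht : t ≠ j := fun h => hst (hs.trans h.symm)
      simp [hs, ht, Ne.symm ht]
      ring_nf
      simp
    · by_cases ht : t = j
      · simp [hs, ht]
      · simp [hst, hs, ht]

theorem sum_sqrtDecomp_snd (hd : 2 ≤ d) (hε₀ : 0 < ε) (hε₁ : ε < 1) (x : Fin d) :
    ∑ j, sqrtDecomp d ε x j = noisyMeas d ε x := by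
  have hd0 : (d : ℂ) ≠ 0 := by exact_mod_cast (by omega : d ≠ 0)
  have hdd : (d : ℂ)⁻¹ * d = 1 := inv_mul_cancel₀ hd0
  have hb : (eigBot d ε : ℂ) ^ 2 = ε / d := by exact_mod_cast eigBot_sq hε₀
  have ha : (eigTop d ε : ℂ) ^ 2 = 1 - ε + ε / d := by exact_mod_cast eigTop_sq hε₀ hε₁
  ext s t
  rw [Matrix.sum_apply, noisyMeas_eq, Matrix.diagonal_apply]
  simp only [sqrtDecomp_apply hd hε₀]
  rw [← Complex.ofReal_sum, ← Finset.mul_sum, Finset.sum_add_distrib]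
  simp only [sub_mul, mul_sub, Finset.sum_sub_distrib, diagCorrection]
  by_cases hst : s = t
  · subst hst
    by_cases hs : s = x
    · simp [hs]
      linear_combination (eigTop d ε : ℂ) ^ 2 * hdd + ha
    · simp [hs]
      linear_combination (eigBot d ε : ℂ) ^ 2 * hdd + hb
  · by_cases hs : s = x
    · have ht : t ≠ x := fun h => hst (hs.trans h.symm)
      simp [hs, ht, Ne.symm ht]
    · by_cases ht : t = x
      · simp [hs, ht]
        right
        ring
      · simp [hst, hs, ht]

theorem posSemidef_sqrtDecomp (hd : 2 ≤ d) (hε₀ : 0 < ε) (x j : Fin d) :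
    (sqrtDecomp d ε x j).PosSemidef := by
  have hd2 : (2 : ℝ) ≤ d := by exact_mod_cast hd
  rw [sqrtDecomp]
  split_ifs
  · refine (posSemidef_ketbra _).add (Matrix.PosSemidef.smul ?_ ?_)
    · set Q := projNe x - ketbra (unbiasedNe d x) with hQ
      have hu : projNe x *ᵥ unbiasedNe d x = unbiasedNe d x := by
        rw [projNe_eq_diagonal, unbiasedNe_eq]
        funext s
        rw [Matrix.mulVec_diagonal]
        by_cases hs : s = x <;> simp [hs]
      have hP : (projNe x)ᴴ = projNe x := by
        rw [projNe, Matrix.conjTranspose_sub, (posSemidef_ketbra _).1.eq,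
          Matrix.conjTranspose_one]
      have hPP : projNe x * projNe x = projNe x := by
        rw [projNe_eq_diagonal, Matrix.diagonal_mul_diagonal]
        congr 1
        funext s
        by_cases hs : s = x <;> simp [hs]
      have hu' : star (unbiasedNe d x) ᵥ* projNe x = star (unbiasedNe d x) := by
        conv_rhs => rw [← hu, Matrix.star_mulVec, hP]
      have hn : star (unbiasedNe d x) ⬝ᵥ unbiasedNe d x = 1 := by
        rw [← trace_ketbra, Matrix.trace]
        simp only [Matrix.diag_apply, ketbra_unbiasedNe_apply hd]
        rw [← Complex.ofReal_sum]
        have h := sum_ite_eq_add x 0 ((d : ℝ) - 1)⁻¹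
        rw [Fintype.card_fin, zero_add, mul_inv_cancel₀ (by linarith)] at h
        rw [← Complex.ofReal_one]
        refine congrArg Complex.ofReal (Eq.trans ?_ h)
        exact Finset.sum_congr rfl fun s _ => by split_ifs <;> rfl
      have hQh : Qᴴ = Q := by
        rw [hQ, Matrix.conjTranspose_sub, (posSemidef_ketbra _).1.eq, hP]
      have hQQ : Q = Q * Qᴴ := by
        rw [hQh, hQ, sub_mul, mul_sub, mul_sub, hPP, ketbra_mul_ketbra, hn, ketbra,
          Matrix.mul_vecMulVec, Matrix.vecMulVec_mul, hu, hu']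
        simp
      rw [hQQ]
      exact Matrix.posSemidef_self_mul_conjTranspose Q
    · exact Complex.zero_le_real.2
        (div_nonneg (mul_nonneg (by linarith) hε₀.le) (sq_nonneg (d : ℝ)))
  · exact posSemidef_ketbra _

end SqrtDecomp

/-! ### The square-root dilation -/

section SqrtPOVM

variable {d : ℕ} {ε : ℝ}

theorem sqrtWeight_eq (hd : 2 ≤ d) (hε₀ : 0 < ε) (hε₁ : ε < 1) (j : Fin d) :
    sqrtWeight d ε j = (d : ℝ)⁻¹ := by
  have hd0 : (d : ℝ) ≠ 0 := by exact_mod_cast (by omega : d ≠ 0)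
  have h : ∑ x, (sqrtDecomp d ε x j).trace.re = 1 := by
    rw [← Complex.re_sum, ← Matrix.trace_sum, sum_sqrtDecomp_fst hd hε₀ hε₁, Matrix.trace_smul,
      Matrix.trace_one, Fintype.card_fin, smul_eq_mul, inv_mul_cancel₀ (by exact_mod_cast hd0),
      Complex.one_re]
  rw [sqrtWeight, h, one_div]

theorem sqrtPOVM_eq (hd : 2 ≤ d) (hε₀ : 0 < ε) (hε₁ : ε < 1) (x j : Fin d) :
    sqrtPOVM d ε x j = (d : ℂ) • sqrtDecomp d ε x j := by
  rw [sqrtPOVM, sqrtWeight_eq hd hε₀ hε₁, Complex.ofReal_inv, inv_inv, Complex.ofReal_natCast]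

theorem posSemidef_sqrtPOVM (hd : 2 ≤ d) (hε₀ : 0 < ε) (hε₁ : ε < 1) (x j : Fin d) :
    (sqrtPOVM d ε x j).PosSemidef := by
  rw [sqrtPOVM_eq hd hε₀ hε₁]
  exact (posSemidef_sqrtDecomp hd hε₀ x j).smul (Nat.cast_nonneg d)

theorem sum_sqrtPOVM (hd : 2 ≤ d) (hε₀ : 0 < ε) (hε₁ : ε < 1) (j : Fin d) :
    ∑ x, sqrtPOVM d ε x j = 1 := by
  have hd0 : (d : ℂ) ≠ 0 := by exact_mod_cast (by omega : d ≠ 0)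
  simp only [sqrtPOVM_eq hd hε₀ hε₁]
  rw [← Finset.smul_sum, sum_sqrtDecomp_fst hd hε₀ hε₁, smul_smul, mul_inv_cancel₀ hd0, one_smul]

/-- The entrywise form of `(√N)ᴴ √N = N`. -/
theorem sum_star_psdSqrt_sqrtPOVM_mul (hd : 2 ≤ d) (hε₀ : 0 < ε) (hε₁ : ε < 1)
    (x j s u : Fin d) :
    ∑ t, star (psdSqrt (sqrtPOVM d ε x j) t s) * psdSqrt (sqrtPOVM d ε x j) t u =
      sqrtPOVM d ε x j s u := by
  have h := psdSqrt_mul_psdSqrt (posSemidef_sqrtPOVM hd hε₀ hε₁ x j)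
  conv_lhs at h => lhs; rw [← (isHermitian_psdSqrt (sqrtPOVM d ε x j)).eq]
  conv_rhs => rw [← h]
  rfl

/-- The prescribed columns of `U`, indexed by the pairs `(s, (x₀, j))`, are orthonormal because
the `N_{x,j}` sum to the identity over `x`; they extend to an orthonormal basis. -/
theorem exists_isSqrtUnitary (hd : 2 ≤ d) (hε₀ : 0 < ε) (hε₁ : ε < 1) (x₀ : Fin d) :
    ∃ U, IsSqrtUnitary d ε x₀ U := by
  let v : Fin d × (Fin d × Fin d) → EuclideanSpace ℂ (Fin d × (Fin d × Fin d)) := fun c =>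
    WithLp.toLp 2 fun r => if r.2.2 = c.2.2 then psdSqrt (sqrtPOVM d ε r.2.1 c.2.2) r.1 c.1 else 0
  have hinner : ∀ c c', inner ℂ (v c) (v c') =
      if c.2.2 = c'.2.2 then if c.1 = c'.1 then 1 else 0 else 0 := by
    rintro ⟨s, y, j⟩ ⟨u, y', j'⟩
    have h1 : inner ℂ (v (s, y, j)) (v (u, y', j')) =
        ∑ t, ∑ x, if j = j' then star (psdSqrt (sqrtPOVM d ε x j) t s) *
          psdSqrt (sqrtPOVM d ε x j') t u else 0 := by
      simp [v, PiLp.inner_apply, Fintype.sum_prod_type, apply_ite (starRingEnd ℂ), mul_comm]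
    rw [h1]
    dsimp only
    by_cases hj : j = j'
    · subst hj
      simp only [if_true]
      rw [Finset.sum_comm]
      simp only [sum_star_psdSqrt_sqrtPOVM_mul hd hε₀ hε₁]
      rw [← Matrix.sum_apply, sum_sqrtPOVM hd hε₀ hε₁, Matrix.one_apply]
    · simp [hj]
  have hv : Orthonormal ℂ (Set.domRestrict {c : Fin d × (Fin d × Fin d) | c.2.1 = x₀} v) := by
    rw [orthonormal_iff_ite]
    rintro ⟨⟨s, y, j⟩, hy⟩ ⟨⟨u, y', j'⟩, hy'⟩
    obtain rfl : y = x₀ := hy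
    obtain rfl : y' = y := hy'
    refine (hinner _ _).trans ?_
    by_cases hj : j = j' <;> by_cases hs : s = u <;> simp [hj, hs]
  obtain ⟨b, hb⟩ := hv.exists_orthonormalBasis_extension_of_card_eq (by simp)
  refine ⟨Matrix.of fun r c => b c r, ?_, ?_⟩
  · rw [Matrix.mem_unitaryGroup_iff']
    ext c c'
    have h := orthonormal_iff_ite.1 b.orthonormal c c'
    rw [Matrix.one_apply, ← h, PiLp.inner_apply]
    simp [Matrix.mul_apply, Matrix.star_eq_conjTranspose, mul_comm]
  · intro s t x i j
    rw [Matrix.of_apply, hb (s, (x₀, j)) rfl]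

variable {x₀ : Fin d} {U : Matrix (Fin d × (Fin d × Fin d)) (Fin d × (Fin d × Fin d)) ℂ}

theorem sqrtProj_apply (hd : 2 ≤ d) (hε₀ : 0 < ε) (hε₁ : ε < 1) (hU : IsSqrtUnitary d ε x₀ U)
    (x s u i j : Fin d) :
    sqrtProj U x (s, (x₀, i)) (u, (x₀, j)) = if i = j then sqrtPOVM d ε x j s u else 0 := by
  have h : sqrtProj U x (s, (x₀, i)) (u, (x₀, j)) =
      ∑ t, ∑ l, star (U (t, (x, l)) (s, (x₀, i))) * U (t, (x, l)) (u, (x₀, j)) := by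
    rw [sqrtProj, Matrix.mul_assoc, Matrix.mul_apply, Fintype.sum_prod_type]
    refine Finset.sum_congr rfl fun t _ => ?_
    rw [Fintype.sum_prod_type, Finset.sum_comm]
    refine Finset.sum_congr rfl fun l _ => ?_
    simp [Matrix.mul_apply, Fintype.sum_prod_type, Matrix.one_apply, ketbra, ket,
      Matrix.vecMulVec_apply, Pi.single_apply, Matrix.conjTranspose_apply]
  rw [h]
  simp only [hU.2]
  by_cases hij : i = j
  · subst hij
    rw [if_pos rfl, ← sum_star_psdSqrt_sqrtPOVM_mul hd hε₀ hε₁]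
    refine Finset.sum_congr rfl fun t _ => ?_
    simp [apply_ite (starRingEnd ℂ)]
  · rw [if_neg hij]
    refine Finset.sum_eq_zero fun t _ => Finset.sum_eq_zero fun l _ => ?_
    by_cases hl : l = i
    · simp [hl, hij]
    · simp [hl]

theorem sum_mul_sqrtVec (hd : 2 ≤ d) (hε₀ : 0 < ε) (hε₁ : ε < 1)
    (F : Fin d × (Fin d × Fin d) → ℂ) (e : Fin d) :
    ∑ u, F u * jointVec (unbiased d) (sqrtVec d ε x₀) (u, e) =
      (d : ℂ)⁻¹ * ∑ s, F (s, (x₀, e)) := by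
  rw [Fintype.sum_prod_type, Finset.mul_sum]
  refine Finset.sum_congr rfl fun s _ => ?_
  rw [Finset.sum_eq_single (x₀, e)]
  · have h := inv_sqrt_mul_inv_sqrt_natCast d
    simp only [jointVec, sqrtVec, unbiased, sqrtWeight_eq hd hε₀ hε₁, Real.sqrt_inv, and_self,
      if_true]
    rw [← Complex.ofReal_mul, h, mul_comm]
    simp
  · rintro ⟨y, j⟩ - hne
    have : ¬ (y = x₀ ∧ j = e) := fun h => hne (Prod.ext h.1 h.2)
    simp [jointVec, sqrtVec, this]
  · simp

theorem traceSnd_ketbra_sqrtVec (hd : 2 ≤ d) (hε₀ : 0 < ε) (hε₁ : ε < 1) :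
    traceSnd (ketbra (sqrtVec d ε x₀)) =
      Matrix.diagonal fun a => if a.1 = x₀ then (d : ℂ)⁻¹ else 0 := by
  ext ⟨y, i⟩ ⟨z, j⟩
  have h : ((√(d : ℝ))⁻¹ : ℂ) * ((√(d : ℝ))⁻¹ : ℂ) = (d : ℂ)⁻¹ := by
    rw [← Complex.ofReal_inv, ← Complex.ofReal_mul, inv_sqrt_mul_inv_sqrt_natCast]
    simp
  by_cases hy : y = x₀ <;> by_cases hz : z = x₀ <;> by_cases hij : i = j <;>
    simp [traceSnd, ketbra, Matrix.vecMulVec_apply, sqrtVec, sqrtWeight_eq hd hε₀ hε₁, hy, hz, hij,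
      Matrix.diagonal_apply, h]
  · exact Or.inr fun h => absurd h.symm hij
  · exact fun h => absurd h.symm hz

/-- The reduced state of `|φ⟩` on `A` is the mixture of the `|x₀, j⟩` with weights `p(j)`, and the
block of `Π_x` selected by `|x₀, j⟩` is `N_{x,j}`; hence the marginal is `∑ j, p(j) N_{x,j}`. -/
theorem isDilation_sqrt (hd : 2 ≤ d) (hε₀ : 0 < ε) (hε₁ : ε < 1) (hU : IsSqrtUnitary d ε x₀ U) :
    IsDilation (noisyMeas d ε) (sqrtProj U) (sqrtVec d ε x₀) := by
  have hd0 : (d : ℝ) ≠ 0 := by exact_mod_cast (by omega : d ≠ 0)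
  have hUU : U * Uᴴ = 1 := Matrix.mem_unitaryGroup_iff.1 hU.1
  have hUU' : Uᴴ * U = 1 := Matrix.mem_unitaryGroup_iff'.1 hU.1
  set D : Fin d → Matrix (Fin d × (Fin d × Fin d)) (Fin d × (Fin d × Fin d)) ℂ := fun x =>
    (1 : Matrix (Fin d) (Fin d) ℂ) ⊗ₖ (ketbra (ket x) ⊗ₖ (1 : Matrix (Fin d) (Fin d) ℂ)) with hD
  have hP : ∀ x, sqrtProj U x = Uᴴ * D x * U := fun x => rfl
  have hmul : ∀ x y, sqrtProj U x * sqrtProj U y = Uᴴ * (D x * D y) * U := by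
    intro x y
    rw [hP, hP, show Uᴴ * D x * U * (Uᴴ * D y * U) = Uᴴ * D x * (U * Uᴴ) * D y * U by
      simp only [Matrix.mul_assoc], hUU, Matrix.mul_one, Matrix.mul_assoc Uᴴ]
  have hDD : ∀ x y, D x * D y = if x = y then D x else 0 := by
    intro x y
    simp only [hD, ← Matrix.mul_kronecker_mul, Matrix.one_mul]
    by_cases hxy : x = y
    · subst hxy
      simp [ketbra_mul_ketbra, ket]
    · simp [ketbra, ket, Matrix.vecMulVec_mul_vecMulVec, hxy, Ne.symm hxy]
  constructor
  · intro x
    refine ⟨?_, ?_⟩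
    · rw [IsIdempotentElem, hmul, hDD, if_pos rfl, hP]
    · have hDh : (D x)ᴴ = D x := by
        simp [hD, Matrix.conjTranspose_kronecker, (posSemidef_ketbra (ket x)).1.eq]
      rw [IsSelfAdjoint, Matrix.star_eq_conjTranspose, hP, Matrix.conjTranspose_mul,
        Matrix.conjTranspose_mul, hDh, Matrix.conjTranspose_conjTranspose, Matrix.mul_assoc]
  · intro x y hxy
    rw [hmul, hDD, if_neg hxy, Matrix.mul_zero, Matrix.zero_mul]
  · have hsum : ∑ x, D x = 1 := by
      ext ⟨s, y, i⟩ ⟨u, z, j⟩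
      simp [hD, Matrix.sum_apply, Matrix.one_apply, ketbra, ket, Matrix.vecMulVec_apply,
        Pi.single_apply]
      split_ifs <;> simp_all
    simp only [hP]
    rw [← Matrix.sum_mul, ← Matrix.mul_sum, hsum, Matrix.mul_one, hUU']
  · rw [Fintype.sum_prod_type, Fintype.sum_prod_type]
    simp [sqrtVec, ite_and, sqrtWeight_eq hd hε₀ hε₁, apply_ite norm]
    exact mul_inv_cancel₀ hd0
  · intro x
    rw [← sum_sqrtDecomp_snd hd hε₀ hε₁ x]
    ext s t
    rw [traceSnd_ketbra_sqrtVec hd hε₀ hε₁, ← Matrix.diagonal_one,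
      Matrix.diagonal_kronecker_diagonal, traceSnd, Matrix.of_apply, Matrix.sum_apply,
      Fintype.sum_prod_type, Finset.sum_eq_single x₀]
    · refine Finset.sum_congr rfl fun j _ => ?_
      rw [Matrix.mul_diagonal, sqrtProj_apply hd hε₀ hε₁ hU, if_pos rfl, if_pos rfl,
        sqrtPOVM_eq hd hε₀ hε₁, Matrix.smul_apply, smul_eq_mul]
      field_simp
    · intro y _ hy
      simp [Matrix.mul_diagonal, hy]
    · simp

theorem sum_diagCorrection (a b : ℝ) (x : Fin d) :
    ∑ s, ∑ t, diagCorrection d a b x s t = (a + (d - 1) * b) ^ 2 - (a - b) ^ 2 := by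
  have hrow : ∀ s, ∑ t, diagCorrection d a b x s t =
      if s = x then a ^ 2 - (a - b) ^ 2 + (d - 1) * (a * b) else a * b + (d - 1) * b ^ 2 := by
    intro s
    simp only [diagCorrection]
    split_ifs with hs
    · rw [sum_ite_eq_add, Fintype.card_fin]
    · have h : ∀ t, (if t = x then a * b else if s = t then ((d : ℝ) - 1) * b ^ 2 else 0) =
          (if t = x then a * b else 0) + if s = t then ((d : ℝ) - 1) * b ^ 2 else 0 := by
        intro t
        by_cases ht : t = x <;> simp [ht, hs]
      simp [h, Finset.sum_add_distrib]
  simp only [hrow]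
  rw [sum_ite_eq_add, Fintype.card_fin]
  ring

/-- Eve learns the classical label `j`, with joint weights `⟨ψ|K_{x,j}|ψ⟩`. -/
theorem eveEnsemble_sqrt (hd : 2 ≤ d) (hε₀ : 0 < ε) (hε₁ : ε < 1) (hU : IsSqrtUnitary d ε x₀ U) :
    eveEnsemble (unbiased d) (sqrtProj U) (sqrtVec d ε x₀) =
      symmetricEnsemble (Fin d) ((eigTop d ε + (d - 1) * eigBot d ε) ^ 2 / d)
        ((eigTop d ε - eigBot d ε) ^ 2 / d) := by
  have hd0 : (d : ℂ) ≠ 0 := by exact_mod_cast (by omega : d ≠ 0)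
  funext x
  ext e f
  have h : eveEnsemble (unbiased d) (sqrtProj U) (sqrtVec d ε x₀) x e f =
      (d : ℂ)⁻¹ * ∑ s, (d : ℂ)⁻¹ * ∑ u, sqrtProj U x (s, (x₀, f)) (u, (x₀, e)) := by
    rw [eveEnsemble, traceFst_kronecker_one_mul_ketbra]
    simp only [← Finset.sum_mul, sum_mul_sqrtVec hd hε₀ hε₁]
    have hstar : ∀ i, star (jointVec (unbiased d) (sqrtVec d ε x₀) i) =
        jointVec (unbiased d) (sqrtVec d ε x₀) i := by
      intro i
      simp [jointVec, unbiased, sqrtVec, apply_ite (starRingEnd ℂ)]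
    simp only [hstar, sum_mul_sqrtVec hd hε₀ hε₁]
  rw [h, symmetricEnsemble, Matrix.diagonal_apply]
  simp only [sqrtProj_apply hd hε₀ hε₁ hU]
  by_cases hef : e = f
  · subst hef
    simp only [if_true, sqrtPOVM_eq hd hε₀ hε₁, Matrix.smul_apply, smul_eq_mul,
      sqrtDecomp_apply hd hε₀, ← Finset.mul_sum, ← Complex.ofReal_sum, Finset.sum_add_distrib]
    by_cases hex : e = x
    · simp only [hex, if_true, sum_diagCorrection, Finset.sum_sub_distrib, Finset.sum_ite_eq',
        Finset.mem_univ, Fintype.card_fin, ← Finset.sum_mul]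
      push_cast
      field_simp
      ring
    · simp only [hex, if_false, Finset.sum_sub_distrib, Finset.sum_ite_eq', Finset.sum_const_zero,
        if_true, Finset.mem_univ, Fintype.card_fin, ← Finset.sum_mul]
      push_cast
      field_simp
      ring
  · simp [hef, Ne.symm hef]

theorem pStar_add_eq_one (hd : 2 ≤ d) (hε₀ : 0 < ε) (hε₁ : ε < 1) :
    (eigTop d ε + (d - 1) * eigBot d ε) ^ 2 / d +
      (Fintype.card (Fin d) - 1) * ((eigTop d ε - eigBot d ε) ^ 2 / d) = 1 := by
  have hd0 : (d : ℝ) ≠ 0 := by exact_mod_cast (by omega : d ≠ 0)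
  have ha := eigTop_sq (d := d) hε₀ hε₁
  have hb := eigBot_sq (d := d) hε₀
  have hab : eigTop d ε ^ 2 + (d - 1) * eigBot d ε ^ 2 = 1 := by
    rw [ha, hb]
    field_simp
    ring
  rw [Fintype.card_fin]
  field_simp
  linear_combination (d : ℝ) * hab

theorem condEntropy_eveEnsemble_sqrt (hd : 2 ≤ d) (hε₀ : 0 < ε) (hε₁ : ε < 1)
    (hU : IsSqrtUnitary d ε x₀ U) (k : Fin d) :
    condEntropy (eveEnsemble (unbiased d) (sqrtProj U) (sqrtVec d ε x₀)) =
      binaryEntropy (pStar d ε k) + (1 - pStar d ε k) * Real.logb 2 ((d : ℝ) - 1) := by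
  have hd0 : (0 : ℝ) < d := by exact_mod_cast (by omega : 0 < d)
  have : Nonempty (Fin d) := ⟨k⟩
  have hQ : 0 < (eigTop d ε - eigBot d ε) ^ 2 / d :=
    div_pos (pow_pos (sub_pos.2 (eigBot_lt_eigTop hε₀ hε₁)) 2) hd0
  rw [eveEnsemble_sqrt hd hε₀ hε₁ hU, pStar_eq,
    condEntropy_symmetricEnsemble (pStar_add_eq_one hd hε₀ hε₁) (by simpa using hd) hQ,
    Fintype.card_fin]

theorem condMaxEntropy_eveEnsemble_sqrt (hd : 2 ≤ d) (hε₀ : 0 < ε) (hε₁ : ε < 1)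
    (hU : IsSqrtUnitary d ε x₀ U) :
    condMaxEntropy (eveEnsemble (unbiased d) (sqrtProj U) (sqrtVec d ε x₀)) =
      Real.logb 2 ((d : ℝ) - ((d : ℝ) - 1) * ε) := by
  have hd2 : (2 : ℝ) ≤ d := by exact_mod_cast hd
  have hd0 : (0 : ℝ) < d := by linarith
  have : Nonempty (Fin d) := ⟨x₀⟩
  have hb := eigBot_pos hd hε₀
  have hab : 0 < eigTop d ε - eigBot d ε := sub_pos.2 (eigBot_lt_eigTop hε₀ hε₁)
  have hP : 0 < eigTop d ε + (d - 1) * eigBot d ε :=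
    add_pos (by linarith) (mul_pos (by linarith) hb)
  rw [condMaxEntropy, eveEnsemble_sqrt hd hε₀ hε₁ hU,
    secrecy_symmetricEnsemble (pStar_add_eq_one hd hε₀ hε₁) (div_pos (pow_pos hP 2) hd0)
      (div_pos (pow_pos hab 2) hd0),
    Real.sqrt_div' _ hd0.le, Real.sqrt_div' _ hd0.le, Real.sqrt_sq hP.le, Real.sqrt_sq hab.le,
    Fintype.card_fin]
  congr 1
  have hs : √(d : ℝ) ^ 2 = d := Real.sq_sqrt hd0.le
  have ha := eigTop_sq (d := d) hε₀ hε₁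
  calc _ = (d * eigTop d ε) ^ 2 / √(d : ℝ) ^ 2 := by rw [← div_pow]; congr 1; ring
    _ = d * eigTop d ε ^ 2 := by rw [hs]; field_simp
    _ = _ := by rw [ha]; field_simp; ring

end SqrtPOVM

end NoisyMeasurement

theorem mainTheorem6 (d : ℕ) (hd : 2 ≤ d) (ε : ℝ) (hε₀ : 0 < ε) (hε₁ : ε < 1) (k : Fin d) :
    -- the square-root dilation exists, is a valid dilation, and has the stated entropies
    (∀ x₀ : Fin d,
      (∃ U, NoisyMeasurement.IsSqrtUnitary d ε x₀ U) ∧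
      ∀ U, NoisyMeasurement.IsSqrtUnitary d ε x₀ U →
        NoisyMeasurement.IsDilation (NoisyMeasurement.noisyMeas d ε)
          (NoisyMeasurement.sqrtProj U) (NoisyMeasurement.sqrtVec d ε x₀) ∧
        NoisyMeasurement.condEntropy
            (NoisyMeasurement.eveEnsemble (NoisyMeasurement.unbiased d)
              (NoisyMeasurement.sqrtProj U) (NoisyMeasurement.sqrtVec d ε x₀)) =
          NoisyMeasurement.binaryEntropy (NoisyMeasurement.pStar d ε k)
            + (1 - NoisyMeasurement.pStar d ε k) * Real.logb 2 ((d : ℝ) - 1) ∧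
        NoisyMeasurement.condMaxEntropy
            (NoisyMeasurement.eveEnsemble (NoisyMeasurement.unbiased d)
              (NoisyMeasurement.sqrtProj U) (NoisyMeasurement.sqrtVec d ε x₀)) =
          Real.logb 2 ((d : ℝ) - ((d : ℝ) - 1) * ε)) ∧
    -- hence the bounds for the minimum over all dilations
    NoisyMeasurement.measEntropy (NoisyMeasurement.unbiased d) (NoisyMeasurement.noisyMeas d ε) ≤
      ((NoisyMeasurement.binaryEntropy (NoisyMeasurement.pStar d ε k)
        + (1 - NoisyMeasurement.pStar d ε k) * Real.logb 2 ((d : ℝ) - 1) : ℝ) : EReal) ∧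
    NoisyMeasurement.measMaxEntropy (NoisyMeasurement.unbiased d)
        (NoisyMeasurement.noisyMeas d ε) ≤
      ((Real.logb 2 ((d : ℝ) - ((d : ℝ) - 1) * ε) : ℝ) : EReal) ∧
    -- the maximal max-entropy of the noisy state, for every purification held by Eve
    (∀ (E : Type) [Fintype E] [DecidableEq E] (Φ : Fin d × E → ℂ),
      NoisyMeasurement.traceSnd (NoisyMeasurement.ketbra Φ) = NoisyMeasurement.noisyState d ε →
      IsGreatest (NoisyMeasurement.basisMaxEntropies Φ)
        (Real.logb 2 ((d : ℝ) - ((d : ℝ) - 1) * ε))) := by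
  have hd0 : 0 < d := by omega
  have hsqrt := fun (x₀ : Fin d) U (hU : NoisyMeasurement.IsSqrtUnitary d ε x₀ U) =>
    And.intro (NoisyMeasurement.isDilation_sqrt hd hε₀ hε₁ hU)
      (And.intro (NoisyMeasurement.condEntropy_eveEnsemble_sqrt hd hε₀ hε₁ hU k)
        (NoisyMeasurement.condMaxEntropy_eveEnsemble_sqrt hd hε₀ hε₁ hU))
  obtain ⟨U, hU⟩ := NoisyMeasurement.exists_isSqrtUnitary hd hε₀ hε₁ k
  obtain ⟨hdil, hH, hHmax⟩ := hsqrt k U hU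
  refine ⟨fun x₀ => ⟨NoisyMeasurement.exists_isSqrtUnitary hd hε₀ hε₁ x₀, hsqrt x₀⟩, ?_, ?_, ?_⟩
  · exact sInf_le ⟨_, _, _, _, _, _, _, _, hdil, by rw [hH]⟩
  · exact sInf_le ⟨_, _, _, _, _, _, _, _, hdil, by rw [hHmax]⟩
  · intro E _ _ Φ hΦ
    exact NoisyMeasurement.isGreatest_basisMaxEntropies hd0.ne' hε₀ hε₁ hΦ
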